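/- **Setting.** Let $S$ be an oriented two-sphere. A disc configuration $\mathbb{D}=(D_0;D_1,\dots,D_m)$ consists of closed discs in $S$, each with a marked point on its boundary, such that $D_1,\dots,D_m$ are pairwise disjoint and lie in $\mathrm{int}\,D_0$. Put $\Sigma_{\mathbb{D}}=D_0\setminus\bigcup_{i\ge1}\mathrm{int}\,D_i$. All diagrams in $\Sigma_{\mathbb D}$ meet each $\partial D_i$ in an even number $2n_i$ of points, ordered along $\partial D_i$ (oriented as the boundary of $D_i$) from the marked point; $(n_0;n_1,\dots,n_m)$ is the signature. *Modules.* A cleaved link with $2n$ points is a link in $S$ meeting an equator with a marked point transversely in $2n$ points, each component meeting the equator, together with a sign $\pm$ for each component, up to orientation-preserving diffeomorphism preserving all this structure; equivalently, a planar matching of the $2n$ points inside the equator, one outside, and a sign for each circle of their union. $\mathcal I_{2n}$ is the free $\mathbb Z[q^{1/2},q^{-1/2}]$-module with basis $I_L$ indexed by the cleaved links $L$ with $2n$ points. *Planar diagrams.* For a planar diagram $P$ (disjoint arcs and circles in $\Sigma_{\mathbb D}$), $\mathcal M(P)$ is the set of closed one-manifolds $M$ obtained from $P$ by filling the discs $D_1,\dots,D_m$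 and $S\setminus\mathrm{int}\,D_0$ with planar matchings, with a sign for each circle of $M$. Let $\partial_i M$ be the cleaved link formed by the circles of $M$ that meet $\partial D_i$, with equator $\partial D_i$ and the signs of $M$. Let $$W(M)=\prod_{C \text{ of sign } +}q^{1-\frac12N(C)}\prod_{C\text{ of sign }-}q^{-1+\frac12N(C)},$$ where $C$ runs over the circles of $M$ and $N(C)$ is the number of boundary circles $\partial D_i$, $i\ge 0$, that meet $C$. The partition map $Z_P:\mathcal I_{2n_1}\otimes\cdots\otimes\mathcal I_{2n_m}\to\mathcal I_{2n_0}$ is the linear map with $$Z_P(I_{L_1}\otimes\cdots\otimes I_{L_m})=\sum_{M\in\mathcal M(P),\ \partial_iM=L_i\ (i\ge1)}W(M)\,I_{\partial_0M}.$$ *Tangle diagrams.* For an oriented tangle diagram $T$ in $\Sigma_{\mathbb D}$ with $n_+$ positive and $n_-$ negative crossings, a resolution $\rho$ assigns $0$ or $1$ to each crossing; $\rho(T)$ is the planar diagram in which each crossing is replaced by its $0$- or $1$-smoothing (the $0$-smoothing is the one that is compatible with the orientation at a positive crossing), and $h(\rho)=\sum_c\rho(c)$. Put $$Z_T=(-1)^{n_-}q^{\,n_+-2n_-}\sum_\rho(-q)^{h(\rho)}Z_{\rho(T)}.$$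 **Theorem.** If $T_1$ and $T_2$ are oriented tangle diagrams of the same signature subordinate to $\mathbb D$ that differ by a Reidemeister move (I, II or III) in a disc in the interior of $\Sigma_{\mathbb D}$, then $Z_{T_1}=Z_{T_2}$. Consequently $Z_{T_1}=Z_{T_2}$ whenever $T_1$ and $T_2$ are related by a finite sequence of Reidemeister moves in the interior of $\Sigma_{\mathbb D}$ and isotopies of diagrams fixing the boundary points, i.e. (by Reidemeister's theorem) $Z_T$ is an isotopy invariant of the oriented tangle in $\Sigma_{\mathbb D}\times[-1,1]$ that $T$ represents. -/

import Mathlib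

open scoped LaurentPolynomial TensorProduct ContDiff

noncomputable section

namespace Tangle

/-! ## Disc configurations in the oriented two-sphere -/

/-- The ambient space of the oriented sphere `S`, the unit sphere with its outward normal. -/
abbrev E3 : Type := EuclideanSpace ℝ (Fin 3)

/-- A parametrised, smoothly embedded closed disc in the unit sphere. The parametrisation is
orientation preserving (outward normal first), so `θ ↦ toFun (exp (θ i))` runs along the boundary
circle in the direction in which it is oriented as the boundary of the disc. The marked point of
the boundary circle is `toFun 1`. -/
structure Disc where
  toFun : ℂ → E3
  smooth : ContDiff ℝ ∞ toFun
  mem_sphere : ∀ z : ℂ, ‖z‖ ≤ 1 → ‖toFun z‖ = 1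
  injOn : Set.InjOn toFun (Metric.closedBall 0 1)
  oriented : ∀ z : ℂ, ‖z‖ ≤ 1 → 0 < Matrix.det (fun i j : Fin 3 =>
    (![toFun z, fderiv ℝ toFun z 1, fderiv ℝ toFun z Complex.I] i) j)

/-- The closed disc as a subset of the sphere. -/
def Disc.carrier (D : Disc) : Set E3 := D.toFun '' Metric.closedBall 0 1

/-- The interior of the disc (relative to the sphere). -/
def Disc.inner (D : Disc) : Set E3 := D.toFun '' Metric.ball 0 1

/-- A disc configuration: the disc `D₀` has the index `none`, the other discs are indexed by `ι`
(for the ordered list `D₁, …, D_m` take `ι = Fin m`). They lie in the interior of `D₀` and are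
pairwise disjoint. -/
structure DiscConfig (ι : Type) where
  disc : Option ι → Disc
  subset_inner : ∀ i, (disc (some i)).carrier ⊆ (disc none).inner
  disjoint : ∀ i j, i ≠ j → Disjoint (disc (some i)).carrier (disc (some j)).carrier

/-- The interior of the planar surface `Σ = D₀ ∖ ⋃ i, int Dᵢ`. -/
def DiscConfig.interior {ι : Type} (𝔻 : DiscConfig ι) : Set E3 :=
  (𝔻.disc none).inner \ ⋃ i, (𝔻.disc (some i)).carrier

/-- The disc configuration with one more disc `Δ`, contained in the interior of `Σ`. The new disc
has the index `some none`, and the `i`-th old disc now has the index `some (some i)`. -/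
def DiscConfig.add {ι : Type} (𝔻 : DiscConfig ι) (Δ : Disc) (h : Δ.carrier ⊆ 𝔻.interior) :
    DiscConfig (Option ι) where
  disc
    | none => 𝔻.disc none
    | some none => Δ
    | some (some i) => 𝔻.disc (some i)
  subset_inner
    | none => fun _ hx => (h hx).1
    | some i => 𝔻.subset_inner i
  disjoint
    | none, none, hij => (hij rfl).elim
    | none, some j, _ => Set.disjoint_left.2 fun _ hx hj =>
        (h hx).2 (Set.mem_iUnion.2 ⟨j, hj⟩)
    | some i, none, _ => Set.disjoint_left.2 fun _ hi hx =>
        (h hx).2 (Set.mem_iUnion.2 ⟨i, hi⟩)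
    | some i, some j, hij => 𝔻.disjoint i j fun e => hij (congrArg some e)

/-! ## Diagrams -/

/-- The ends of the edges of a diagram: a diagram is a graph drawn in `Σ`, with

* a four-valent vertex for each crossing `x`; the four ends at it are numbered counterclockwise by
  `0, 1, 2, 3`, where `0, 2` belong to the strand that passes under and `1, 3` to the strand that
  passes over;
* a two-valent vertex for each `v : V`, an auxiliary marker on a strand (so that circles without
  crossings are cycles of the graph too);
* a one-valent vertex for each of the `2 n_d` points on the boundary of the disc `d`, numbered in
  their order on the oriented boundary circle, starting from the marked point. -/
inductive Slot {ι : Type} (n : Option ι → ℕ) (X V : Type) : Type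
  | cross (x : X) (k : Fin 4)
  | mark (v : V) (b : Bool)
  | bdry (d : Option ι) (j : Fin (2 * n d))

/-- An unoriented diagram of signature `n` with set of crossings `X`, as an abstract graph: the
fixed-point-free involution `edge` exchanges the two ends of each edge. -/
structure Diagram {ι : Type} (n : Option ι → ℕ) (X : Type) where
  V : Type
  [finV : Finite V]
  edge : Slot n X V → Slot n X V
  edge_edge : ∀ s, edge (edge s) = s
  edge_ne : ∀ s, edge s ≠ s

attribute [instance] Diagram.finV

/-- A planar diagram is a diagram without crossings. -/
abbrev PlanarDiagram {ι : Type} (n : Option ι → ℕ) : Type 1 := Diagram n Empty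

/-- A drawing of `D` in the surface `Σ` of the disc configuration `𝔻`: the vertices are placed at
distinct points, the boundary points on the boundary circles in their order from the marked point,
the other ones in the interior; the edges are arcs with disjoint interiors in the interior
of `Σ`; and in a suitable orientation preserving disc around a crossing, the four edges that end
there leave it along the rays `1, i, -1, -i`, in this order. -/
structure Drawing {ι : Type} (𝔻 : DiscConfig ι) {n : Option ι → ℕ} {X : Type}
    (D : Diagram n X) where
  /-- the boundary points, as angles -/
  angle : (d : Option ι) → Fin (2 * n d) → ℝ
  angle_mem : ∀ d j, angle d j ∈ Set.Ioo 0 (2 * Real.pi)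
  angle_mono : ∀ d, StrictMono (angle d)
  /-- the crossings and the markers -/
  pos : X ⊕ D.V → E3
  pos_mem : ∀ p, pos p ∈ 𝔻.interior
  pos_inj : Function.Injective pos
  /-- `arc s`, on `[0, 1]`, is the edge with the end `s`, traversed from `s` -/
  arc : Slot n X D.V → ℝ → E3
  arc_cont : ∀ s, ContinuousOn (arc s) (Set.Icc 0 1)
  arc_edge : ∀ s, ∀ t ∈ Set.Icc (0 : ℝ) 1, arc (D.edge s) t = arc s (1 - t)
  arc_mem : ∀ s, ∀ t ∈ Set.Ioo (0 : ℝ) 1, arc s t ∈ 𝔻.interior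
  arc_inj : ∀ s s', ∀ t ∈ Set.Ioo (0 : ℝ) 1, ∀ t' ∈ Set.Ioo (0 : ℝ) 1, arc s t = arc s' t' →
    (s' = s ∧ t' = t) ∨ (s' = D.edge s ∧ t' = 1 - t)
  arc_ne : ∀ s, ∀ t ∈ Set.Ioo (0 : ℝ) 1, ∀ p, arc s t ≠ pos p
  arc_cross : ∀ x k, arc (.cross x k) 0 = pos (.inl x)
  arc_mark : ∀ v b, arc (.mark v b) 0 = pos (.inr v)
  arc_bdry : ∀ d j, arc (.bdry d j) 0 = (𝔻.disc d).toFun (Complex.exp (angle d j * Complex.I))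
  /-- the disc around a crossing -/
  chart : X → Disc
  chart_ray : ∀ x (k : Fin 4), ∃ ε ∈ Set.Ioo (0 : ℝ) 1,
    (chart x).toFun '' ((fun u : ℝ => (u : ℂ) * Complex.I ^ (k : ℕ)) '' Set.Icc 0 1) =
      arc (.cross x k) '' Set.Icc 0 ε

/-- An orientation of the strands of a diagram: `out s` says that at the end `s` the strand is
directed away from the vertex, into the edge. -/
structure StrandOrientation {ι : Type} {n : Option ι → ℕ} {X : Type} (D : Diagram n X) where
  out : Slot n X D.V → Bool
  out_edge : ∀ s, out (D.edge s) = !out s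
  out_cross : ∀ x k, out (.cross x (k + 2)) = !out (.cross x k)
  out_mark : ∀ v b, out (.mark v (!b)) = !out (.mark v b)

/-- An oriented tangle diagram of signature `n` subordinate to the disc configuration `𝔻`. -/
structure TangleDiagram {ι : Type} (𝔻 : DiscConfig ι) (n : Option ι → ℕ) where
  X : Type
  [fintypeX : Fintype X]
  [decEqX : DecidableEq X]
  diagram : Diagram n X
  drawing : Drawing 𝔻 diagram
  orient : StrandOrientation diagram

attribute [instance] TangleDiagram.fintypeX TangleDiagram.decEqX

/-! ## Cleaved links and the modules `I_{2n}` -/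

/-- The ring `ℤ[q^{1/2}, q^{-1/2}]`; the variable `T 1` is `q^{1/2}`, so `T 2` is `q`. -/
abbrev Coeff : Type := ℤ[T;T⁻¹]

/-- Planar (non-crossing) perfect matchings of `2n` points on the boundary of a disc: the isotopy
classes of `n` disjoint arcs properly embedded in the disc with these end points. -/
abbrev PlanarMatching (n : ℕ) : Type :=
  {f : Fin (2 * n) → Fin (2 * n) //
    (∀ i, f (f i) = i) ∧ (∀ i, f i ≠ i) ∧ ∀ i j, i < j → j < f i → i < f j ∧ f j < f i}

/-- Cleaved links, up to equivalence: a link that meets the equator in `2n` points, with no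
component disjoint from it, is given by a planar matching in the disc inside the equator and one in
the disc outside it. The decoration is a sign (`true` for `+`) for each component of the link,
recorded as a function on the `2n` points that is constant along the components. -/
@[ext]
structure CleavedLink (n : ℕ) where
  inside : PlanarMatching n
  outside : PlanarMatching n
  sign : Fin (2 * n) → Bool
  sign_inside : ∀ j, sign (inside.1 j) = sign j
  sign_outside : ∀ j, sign (outside.1 j) = sign j

instance (n : ℕ) : Finite (CleavedLink n) :=
  Finite.of_injective (fun L => (L.inside, L.outside, L.sign)) fun L L' h => by
    simp only [Prod.mk.injEq] at h
    exact CleavedLink.ext h.1 h.2.1 h.2.2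

/-- The free module `I_{2n}` on the cleaved links with `2n` points. -/
abbrev CleavedModule (n : ℕ) : Type := CleavedLink n →₀ Coeff

/-- The matching of a cleaved link on the side of the disc that is filled in at the boundary circle
of index `d`: this is the inside of `Dᵢ` for `i ≥ 1`, and the outside of `D₀`. -/
def CleavedLink.near {n : ℕ} {ι : Type} : Option ι → CleavedLink n → PlanarMatching n
  | none, L => L.outside
  | some _, L => L.inside

/-- The matching of a cleaved link on the other side of the boundary circle of index `d`. -/
def CleavedLink.far {n : ℕ} {ι : Type} : Option ι → CleavedLink n → PlanarMatching n
  | none, L => L.inside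
  | some _, L => L.outside

/-! ## Multiply cleaved links and the partition map of a planar diagram -/

section Planar

variable {ι : Type} {n : Option ι → ℕ}

/-- Two ends are adjacent along a strand: they are the ends of one edge or lie at one marker. -/
def Diagram.Step {X : Type} (D : Diagram n X) (s t : Slot n X D.V) : Prop :=
  t = D.edge s ∨ ∃ v b, s = .mark v b ∧ t = .mark v (!b)

/-- A choice of arcs in the outside disc of `D₀` and in the inside discs `Dᵢ`, `i ≥ 1`. -/
abbrev Filling (n : Option ι → ℕ) : Type := (d : Option ι) → PlanarMatching (n d)

/-- Adjacency in the union of `P` and the arcs of the filling `f` in the discs `d ∈ F`. -/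
def PlanarDiagram.FillStep (P : PlanarDiagram n) (f : Filling n) (F : Set (Option ι))
    (s t : Slot n Empty P.V) : Prop :=
  P.Step s t ∨ ∃ d ∈ F, ∃ j, s = .bdry d j ∧ t = .bdry d ((f d).1 j)

/-- The circles of the closed one-manifold `M` obtained from `P` by filling in all discs. -/
def PlanarDiagram.Circles (P : PlanarDiagram n) (f : Filling n) : Type :=
  Quot (P.FillStep f Set.univ)

instance (V : Type) [Finite ι] [Finite V] : Finite (Slot n Empty V) :=
  Finite.of_surjective
    (fun a : (V × Bool) ⊕ (Σ d : Option ι, Fin (2 * n d)) => (match a with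
      | .inl p => .mark p.1 p.2
      | .inr p => .bdry p.1 p.2 : Slot n Empty V))
    (by
      rintro (⟨x, -⟩ | ⟨v, b⟩ | ⟨d, j⟩)
      · exact x.elim
      · exact ⟨.inl (v, b), rfl⟩
      · exact ⟨.inr ⟨d, j⟩, rfl⟩)

instance [Finite ι] (P : PlanarDiagram n) (f : Filling n) : Finite (P.Circles f) :=
  inferInstanceAs (Finite (Quot _))

/-- The decorated multiply cleaved links `M` with associated planar diagram `P`, i.e. the elements
of `ℳ(P)`: fillings of all discs, with a sign (`true` for `+`) for each circle. -/
def PlanarDiagram.MultiLink (P : PlanarDiagram n) : Type :=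
  Σ f : Filling n, (P.Circles f → Bool)

instance [Finite ι] (P : PlanarDiagram n) : Finite P.MultiLink :=
  inferInstanceAs (Finite (Σ f : Filling n, (P.Circles f → Bool)))

/-- The circle of `M` through a boundary point. -/
def PlanarDiagram.circleAt (P : PlanarDiagram n) (f : Filling n) (d : Option ι)
    (j : Fin (2 * n d)) : P.Circles f :=
  Quot.mk _ (.bdry d j)

/-- `N_M(C)`, the number of boundary circles that meet the circle `C` of `M`. -/
def PlanarDiagram.meets (P : PlanarDiagram n) (f : Filling n) (C : P.Circles f) : ℕ :=
  Nat.card {d : Option ι // ∃ j, P.circleAt f d j = C}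

/-- `∂_d M = L`: on the filled side of the boundary circle `d`, `L` has the arcs of `M` in the disc;
on the other side its arcs join the end points of the strands of `M` outside this disc; and
each point has the sign of the circle of `M` on which it lies. -/
def PlanarDiagram.IsBoundary (P : PlanarDiagram n) (M : P.MultiLink) (d : Option ι)
    (L : CleavedLink (n d)) : Prop :=
  L.near d = M.1 d ∧
  (∀ j, Relation.EqvGen (P.FillStep M.1 {d}ᶜ) (.bdry d j) (.bdry d ((L.far d).1 j))) ∧
  ∀ j, L.sign j = M.2 (P.circleAt M.1 d j)

/-- The weight `W(M)`: a circle `C` contributes `q^{1 - N(C)/2}` if its sign is `+`, and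
`q^{-1 + N(C)/2}` if its sign is `-`. -/
def PlanarDiagram.weight (P : PlanarDiagram n) [Finite ι] (M : P.MultiLink) : Coeff :=
  letI : Fintype (P.Circles M.1) := Fintype.ofFinite _
  ∏ C : P.Circles M.1, LaurentPolynomial.T
    (if M.2 C then 2 - (P.meets M.1 C : ℤ) else -2 + (P.meets M.1 C : ℤ))

open Classical in
/-- The sum of the weights of the `M ∈ ℳ(P)` with the boundaries `∂_d M = L_d` for all `d`, that is
the coefficient of `I_{L₀}` in the value of `Z_P` at `I_{L₁} ⊗ ⋯ ⊗ I_{L_m}`. -/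
def PlanarDiagram.coeff (P : PlanarDiagram n) [Finite ι]
    (L₀ : CleavedLink (n none)) (L : (i : ι) → CleavedLink (n (some i))) : Coeff :=
  letI : Fintype P.MultiLink := Fintype.ofFinite _
  ∑ M : P.MultiLink,
    if P.IsBoundary M none L₀ ∧ ∀ i, P.IsBoundary M (some i) (L i) then P.weight M else 0

/-- The partition map `Z_P : I_{2n₁} ⊗ ⋯ ⊗ I_{2n_m} → I_{2n₀}`, given on the basis. -/
def PlanarDiagram.Z (P : PlanarDiagram n) [Finite ι] :
    (⨂[Coeff] i : ι, CleavedModule (n (some i))) →ₗ[Coeff] CleavedModule (n none) :=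
  letI : Fintype (CleavedLink (n none)) := Fintype.ofFinite _
  (Basis.piTensorProduct fun i : ι =>
      (Finsupp.basisSingleOne : Module.Basis (CleavedLink (n (some i))) Coeff _)).constr Coeff
    fun L => ∑ L₀ : CleavedLink (n none), P.coeff L₀ L • Finsupp.single L₀ (1 : Coeff)

end Planar

/-! ## Resolutions and the partition map of a tangle diagram -/

section Resolutions

variable {ι : Type} {n : Option ι → ℕ}

/-- The two arcs that replace a crossing. The `0`-resolution (`r = false`) joins the ends
`0` with `1` and `2` with `3`, the `1`-resolution joins `1` with `2` and `3` with `0`. The result is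
the crossing end at the end `p.2` of the arc `p.1`. -/
def smoothing (r : Bool) : Bool × Bool ≃ Fin 4 where
  toFun p := match r, p with
    | false, (false, false) => 0
    | false, (false, true) => 1
    | false, (true, false) => 2
    | false, (true, true) => 3
    | true, (false, false) => 1
    | true, (false, true) => 2
    | true, (true, false) => 3
    | true, (true, true) => 0
  invFun k := match r, k with
    | false, 0 => (false, false)
    | false, 1 => (false, true)
    | false, 2 => (true, false)
    | false, 3 => (true, true)
    | true, 1 => (false, false)
    | true, 2 => (false, true)
    | true, 3 => (true, false)
    | true, 0 => (true, true)
  left_inv := by revert r; decide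
  right_inv := by revert r; decide

/-- In a resolution, each crossing is replaced by two markers, one on each of the two arcs. -/
def resolveSlot {X V : Type} (ρ : X → Bool) :
    Slot n Empty (V ⊕ X × Bool) ≃ Slot n X V where
  toFun
    | .mark (.inl v) b => .mark v b
    | .mark (.inr (x, a)) b => .cross x (smoothing (ρ x) (a, b))
    | .bdry d j => .bdry d j
  invFun
    | .cross x k => .mark (.inr (x, ((smoothing (ρ x)).symm k).1)) ((smoothing (ρ x)).symm k).2
    | .mark v b => .mark (.inl v) b
    | .bdry d j => .bdry d j
  left_inv := by
    rintro (⟨x, -⟩ | ⟨v | ⟨x, a⟩, b⟩ | ⟨d, j⟩)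
    · exact x.elim
    · rfl
    · simp
    · rfl
  right_inv := by
    rintro (⟨x, k⟩ | ⟨v, b⟩ | ⟨d, j⟩)
    · simp
    · rfl
    · rfl

/-- The resolution diagram `ρ(T)`. -/
def Diagram.resolve {X : Type} [Finite X] (D : Diagram n X) (ρ : X → Bool) : PlanarDiagram n where
  V := D.V ⊕ X × Bool
  edge s := (resolveSlot ρ).symm (D.edge (resolveSlot ρ s))
  edge_edge s := by simp [D.edge_edge]
  edge_ne s h := D.edge_ne (resolveSlot ρ s) (by
    simpa using congrArg (resolveSlot ρ) h)

/-- The unshifted partition map: the state sum of `(-q)^{h(ρ)} Z_{ρ(T)}` over all resolutions. -/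
def Diagram.Zunshifted {X : Type} [Fintype X] [DecidableEq X] [Finite ι] (D : Diagram n X) :
    (⨂[Coeff] i : ι, CleavedModule (n (some i))) →ₗ[Coeff] CleavedModule (n none) :=
  ∑ ρ : X → Bool, (-LaurentPolynomial.T 2 : Coeff) ^ (∑ x, if ρ x then 1 else 0) •
    (D.resolve ρ).Z

/-- A crossing is positive if, when the under strand enters at the end `0`, the over strand leaves
at the end `1` (equivalently, by symmetry, if exactly one of the ends `0`, `1` is outgoing). -/
def StrandOrientation.IsPositive {X : Type} {D : Diagram n X} (o : StrandOrientation D)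
    (x : X) : Prop :=
  o.out (.cross x 0) ≠ o.out (.cross x 1)

variable {𝔻 : DiscConfig ι}

/-- The number of positive crossings. -/
def TangleDiagram.nPos (T : TangleDiagram 𝔻 n) : ℕ := Nat.card {x : T.X // T.orient.IsPositive x}

/-- The number of negative crossings. -/
def TangleDiagram.nNeg (T : TangleDiagram 𝔻 n) : ℕ :=
  Nat.card {x : T.X // ¬ T.orient.IsPositive x}

/-- The partition map `Z_T = (-1)^{n₋} q^{n₊ - 2 n₋} Z̃_T` of an oriented tangle diagram. -/
def TangleDiagram.Z [Finite ι] (T : TangleDiagram 𝔻 n) :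
    (⨂[Coeff] i : ι, CleavedModule (n (some i))) →ₗ[Coeff] CleavedModule (n none) :=
  ((-1 : Coeff) ^ T.nNeg * LaurentPolynomial.T (2 * ((T.nPos : ℤ) - 2 * (T.nNeg : ℤ)))) •
    T.diagram.Zunshifted

end Resolutions

/-! ## Reidemeister moves -/

section Moves

variable {ι : Type} {n : Option ι → ℕ}

/-- Forgetting the markers: `φ` on the ends at crossings and boundary points, given a bijection `e`
of crossings and the crossings `r` at which the numbering of the ends is rotated by `2`. -/
def mapSlot {X X' V V' : Type} (e : X ≃ X') (r : X → Bool) :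
    (X × Fin 4) ⊕ (Σ d : Option ι, Fin (2 * n d)) → Slot n X V × Slot n X' V'
  | .inl (x, k) => (.cross x k, .cross (e x) (if r x then k + 2 else k))
  | .inr ⟨d, j⟩ => (.bdry d j, .bdry d j)

/-- The number of closed strands of `D` without crossings. -/
def Diagram.numLoops {X : Type} (D : Diagram n X) : ℕ :=
  Nat.card {c : Quot D.Step // (∀ x k, Quot.mk _ (.cross x k) ≠ c) ∧
    ∀ d j, Quot.mk _ (.bdry d j) ≠ c}

/-- Two oriented diagrams represent the same oriented diagram: they agree up to a renaming of the
crossings, a rotation by `2` of the numbering of the ends at crossings, and the choice of the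
markers. Diagrams in `Σ` that differ by an isotopy of `Σ` are the same in this sense. -/
def SameDiagram {X X' : Type} {D : Diagram n X} {D' : Diagram n X'}
    (o : StrandOrientation D) (o' : StrandOrientation D') : Prop :=
  ∃ (e : X ≃ X') (r : X → Bool),
    (∀ a b, Relation.EqvGen D.Step (mapSlot (V' := D'.V) e r a).1 (mapSlot (V' := D'.V) e r b).1 ↔
      Relation.EqvGen D'.Step (mapSlot (V := D.V) e r a).2 (mapSlot (V := D.V) e r b).2) ∧
    D.numLoops = D'.numLoops ∧
    ∀ a, o.out (mapSlot (V' := D'.V) e r a).1 = o'.out (mapSlot (V := D.V) e r a).2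

/-- The signature `n`, extended by a disc with `2k` points. -/
def addDisc (n : Option ι → ℕ) (k : ℕ) : Option (Option ι) → ℕ
  | none => n none
  | some none => k
  | some (some i) => n (some i)

/-- The signature of a diagram in a disc, with `2k` boundary points. -/
def oneDisc (k : ℕ) : Option Empty → ℕ := fun _ => k

/-- When a diagram in a disc `Δ` is glued into a diagram outside `Δ`, the `2k` points of the
boundary of `Δ` become markers. -/
def glueSlot {X X' V V' : Type} {k : ℕ} :
    Slot n (X ⊕ X') (V ⊕ V' ⊕ Fin (2 * k)) ≃
      Slot (addDisc n k) X V ⊕ Slot (oneDisc k) X' V' where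
  toFun
    | .cross (.inl x) a => .inl (.cross x a)
    | .cross (.inr x) a => .inr (.cross x a)
    | .mark (.inl v) b => .inl (.mark v b)
    | .mark (.inr (.inl v)) b => .inr (.mark v b)
    | .mark (.inr (.inr j)) false => .inl (.bdry (some none) j)
    | .mark (.inr (.inr j)) true => .inr (.bdry none j)
    | .bdry none j => .inl (.bdry none j)
    | .bdry (some i) j => .inl (.bdry (some (some i)) j)
  invFun
    | .inl (.cross x a) => .cross (.inl x) a
    | .inl (.mark v b) => .mark (.inl v) b
    | .inl (.bdry none j) => .bdry none j
    | .inl (.bdry (some none) j) => .mark (.inr (.inr j)) false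
    | .inl (.bdry (some (some i)) j) => .bdry (some i) j
    | .inr (.cross x a) => .cross (.inr x) a
    | .inr (.mark v b) => .mark (.inr (.inl v)) b
    | .inr (.bdry none j) => .mark (.inr (.inr j)) true
  left_inv := by
    rintro (⟨x | x, a⟩ | ⟨v | v | j, _ | _⟩ | ⟨_ | i, j⟩) <;> rfl
  right_inv := by
    rintro ((⟨x, a⟩ | ⟨v, b⟩ | ⟨_ | _ | i, j⟩) | (⟨x, a⟩ | ⟨v, b⟩ | ⟨_ | i, j⟩))
    all_goals first | rfl | exact i.elim

/-- The composition `R ∘ A`: the diagram `A` in the disc `Δ` is glued into the diagram `R` outside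
`Δ`, so that the `j`-th points on the boundary of `Δ` are identified. -/
def glue {X X' : Type} {k : ℕ} (R : Diagram (addDisc n k) X) (A : Diagram (oneDisc k) X') :
    Diagram n (X ⊕ X') where
  V := R.V ⊕ A.V ⊕ Fin (2 * k)
  edge s := glueSlot.symm (Sum.map R.edge A.edge (glueSlot s))
  edge_edge s := by
    rcases h : glueSlot s with t | t
    · simp only [Equiv.apply_symm_apply, Sum.map_inl, R.edge_edge]
      rw [← h, Equiv.symm_apply_apply]
    · simp only [Equiv.apply_symm_apply, Sum.map_inr, A.edge_edge]
      rw [← h, Equiv.symm_apply_apply]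
  edge_ne s hs := by
    have hs' := congrArg glueSlot hs
    rw [Equiv.apply_symm_apply] at hs'
    rcases h : glueSlot s with t | t
    · rw [h] at hs'; exact R.edge_ne t (Sum.inl.inj hs')
    · rw [h] at hs'; exact A.edge_ne t (Sum.inr.inj hs')

/-- The positions of the ends in a diagram with `c` crossings in a disc with `2k` boundary points:
`(x, g)` for the four ends at the crossing `x`, numbered counterclockwise, and the boundary
points. -/
abbrev LocalSlot (c k : ℕ) : Type := (Fin c × Fin 4) ⊕ Fin (2 * k)

/-- The ends of a local diagram by their positions. The end `k` at the crossing `x` has the position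
`k` or `k + 1`; so if `r x` is false, the strand through the positions `0, 2` passes under, and
if `r x` is true, it passes over. -/
def localSlot {c k : ℕ} (r : Fin c → Bool) : Slot (oneDisc k) (Fin c) Empty ≃ LocalSlot c k where
  toFun
    | .cross x a => .inl (x, if r x then a + 1 else a)
    | .bdry none j => .inr j
  invFun
    | .inl (x, g) => .cross x (if r x then g - 1 else g)
    | .inr j => .bdry none j
  left_inv := by
    rintro (⟨x, a⟩ | ⟨v, b⟩ | ⟨_ | i, j⟩)
    · cases h : r x <;> simp [h]
    · exact v.elim
    · rfl
    · exact i.elim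
  right_inv := by
    rintro (⟨x, g⟩ | j)
    · cases h : r x <;> simp [h]
    · rfl

/-- The local diagram with the edges `p`, and with over/under information `r`. -/
def localDiagram {c k : ℕ} (r : Fin c → Bool) (p : LocalSlot c k → LocalSlot c k)
    (h₁ : ∀ s, p (p s) = s) (h₂ : ∀ s, p s ≠ s) : Diagram (oneDisc k) (Fin c) where
  V := Empty
  edge s := (localSlot r).symm (p (localSlot r s))
  edge_edge s := by simp [h₁]
  edge_ne s h := h₂ (localSlot r s) (by simpa using congrArg (localSlot r) h)

/-- One strand. -/
def pairs1 : LocalSlot 0 1 → LocalSlot 0 1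
  | .inr 0 => .inr 1
  | .inr 1 => .inr 0

/-- One strand with a kink. -/
def pairs1' : LocalSlot 1 1 → LocalSlot 1 1
  | .inl (0, 0) => .inl (0, 1)
  | .inl (0, 1) => .inl (0, 0)
  | .inl (0, 2) => .inr 0
  | .inr 0 => .inl (0, 2)
  | .inl (0, 3) => .inr 1
  | .inr 1 => .inl (0, 3)

/-- Two disjoint strands, from the point `0` to `3` and from `1` to `2`. -/
def pairs2 : LocalSlot 0 2 → LocalSlot 0 2
  | .inr 0 => .inr 3
  | .inr 3 => .inr 0
  | .inr 1 => .inr 2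
  | .inr 2 => .inr 1

/-- Two strands that cross twice. The strand from the boundary point `0` to `3` passes through the
positions `3, 1` of the first crossing and `1, 3` of the second one; the strand from `1` to `2`
passes through the positions `0, 2` of the first and `0, 2` of the second one. -/
def pairs2' : LocalSlot 2 2 → LocalSlot 2 2
  | .inr 0 => .inl (0, 3)
  | .inl (0, 3) => .inr 0
  | .inl (0, 1) => .inl (1, 1)
  | .inl (1, 1) => .inl (0, 1)
  | .inl (1, 3) => .inr 3
  | .inr 3 => .inl (1, 3)
  | .inr 1 => .inl (0, 0)
  | .inl (0, 0) => .inr 1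
  | .inl (0, 2) => .inl (1, 0)
  | .inl (1, 0) => .inl (0, 2)
  | .inl (1, 2) => .inr 2
  | .inr 2 => .inl (1, 2)

/-- Three strands that cross pairwise, the `i`-th one from the boundary point `i` to `i + 3`. The
crossings `0, 1, 2` are those of the strands `01`, `02`, `12`. At the crossing of the strands
`i < j`, the positions `0, 2` are on the strand `i`, and `1, 3` on the strand `j`, with `0` and `1`
towards the boundary points `i` and `j`. In this diagram the crossings appear along the strands as
`01, 02` on the strand `0`, `01, 12` on the strand `1`, `02, 12` on the strand `2`. -/
def pairs3 : LocalSlot 3 3 → LocalSlot 3 3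
  | .inr 0 => .inl (0, 0)
  | .inl (0, 0) => .inr 0
  | .inl (0, 2) => .inl (1, 0)
  | .inl (1, 0) => .inl (0, 2)
  | .inl (1, 2) => .inr 3
  | .inr 3 => .inl (1, 2)
  | .inr 1 => .inl (0, 1)
  | .inl (0, 1) => .inr 1
  | .inl (0, 3) => .inl (2, 0)
  | .inl (2, 0) => .inl (0, 3)
  | .inl (2, 2) => .inr 4
  | .inr 4 => .inl (2, 2)
  | .inr 2 => .inl (1, 1)
  | .inl (1, 1) => .inr 2
  | .inl (1, 3) => .inl (2, 1)
  | .inl (2, 1) => .inl (1, 3)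
  | .inl (2, 3) => .inr 5
  | .inr 5 => .inl (2, 3)

/-- The same three strands on the other side of the triangle: the crossings appear along them as
`02, 01` on the strand `0`, `12, 01` on the strand `1`, `12, 02` on the strand `2`. -/
def pairs3' : LocalSlot 3 3 → LocalSlot 3 3
  | .inr 0 => .inl (1, 0)
  | .inl (1, 0) => .inr 0
  | .inl (1, 2) => .inl (0, 0)
  | .inl (0, 0) => .inl (1, 2)
  | .inl (0, 2) => .inr 3
  | .inr 3 => .inl (0, 2)
  | .inr 1 => .inl (2, 0)
  | .inl (2, 0) => .inr 1
  | .inl (2, 2) => .inl (0, 1)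
  | .inl (0, 1) => .inl (2, 2)
  | .inl (0, 3) => .inr 4
  | .inr 4 => .inl (0, 3)
  | .inr 2 => .inl (2, 1)
  | .inl (2, 1) => .inr 2
  | .inl (2, 3) => .inl (1, 1)
  | .inl (1, 1) => .inl (2, 3)
  | .inl (1, 3) => .inr 5
  | .inr 5 => .inl (1, 3)

/-- The strands of the third move lie at different heights, the `i`-th one at the height `h i`. The
result says at which crossings the strand `i` passes over the strand `j`, where `i < j`. -/
def heights (h : Equiv.Perm (Fin 3)) : Fin 3 → Bool
  | 0 => decide (h 1 < h 0)
  | 1 => decide (h 2 < h 0)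
  | 2 => decide (h 2 < h 1)

/-- The pairs of diagrams in a disc with `2k` boundary points that are exchanged by a Reidemeister
move. The crossing in the first move is arbitrary; in the second move, one of the two strands passes
over the other one at both crossings; in the third one, the three strands have different heights. -/
inductive LocalMove : {k c c' : ℕ} → Diagram (oneDisc k) (Fin c) → Diagram (oneDisc k) (Fin c') →
    Prop
  | one (r : Bool) : LocalMove
      (localDiagram (fun _ => false) pairs1 (by decide) (by decide))
      (localDiagram (fun _ => r) pairs1' (by decide) (by decide))
  | two (r : Bool) : LocalMove
      (localDiagram (fun _ => false) pairs2 (by decide) (by decide))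
      (localDiagram (fun _ => r) pairs2' (by decide) (by decide))
  | three (h : Equiv.Perm (Fin 3)) : LocalMove
      (localDiagram (heights h) pairs3 (by decide) (by decide))
      (localDiagram (heights h) pairs3' (by decide) (by decide))

/-- `T₂` arises from `T₁` by a Reidemeister move (from the first to the second diagram of a
local move) in a disc `Δ` in the interior of `Σ`: they are given
by the same diagram `R`, drawn in `Σ ∖ int Δ`, and by the two diagrams of a local move
in `Δ`, with orientations that agree outside `Δ`. (The labels of the points on the boundary of `Δ`
depend on its marked point, so the local moves are used up to rotation.) -/
def ReidemeisterMove {𝔻 : DiscConfig ι} (T₁ T₂ : TangleDiagram 𝔻 n) : Prop :=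
  ∃ (Δ : Disc) (hΔ : Δ.carrier ⊆ 𝔻.interior) (k c c' : ℕ) (X : Type)
    (R : Diagram (addDisc n k) X) (_ : Drawing (𝔻.add Δ hΔ) R)
    (A : Diagram (oneDisc k) (Fin c)) (B : Diagram (oneDisc k) (Fin c'))
    (o₁ : StrandOrientation (glue R A)) (o₂ : StrandOrientation (glue R B)),
    LocalMove A B ∧
    (∀ s, o₁.out (glueSlot.symm (.inl s)) = o₂.out (glueSlot.symm (.inl s))) ∧
    SameDiagram T₁.orient o₁ ∧ SameDiagram T₂.orient o₂

/-- The equivalence relation generated by Reidemeister moves and isotopies of diagrams. -/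
def ReidemeisterEquiv {𝔻 : DiscConfig ι} : TangleDiagram 𝔻 n → TangleDiagram 𝔻 n → Prop :=
  Relation.EqvGen fun T₁ T₂ => SameDiagram T₁.orient T₂.orient ∨ ReidemeisterMove T₁ T₂

end Moves

end Tangle

end

/-!
A planar diagram `P` enters its partition map only through two data: which boundary points are
joined by its strands, and how many closed strands it has. A closed strand meets no boundary
circle, so its sign is free and it contributes the factor `q + q⁻¹` (`PlanarDiagram.Z_eq`).

Both data of a diagram that is put together from pieces are computed by one principle, which is used
for filling the discs, for resolving the crossings and for gluing a diagram into a disc: if a relation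
on a set `S` is extended by relations between the images of the points of a set `B`, then the classes
of the new relation are those of a relation on `B`, and the old classes that do not meet the image
of `B` (`quotJoinEquiv`). It follows that the partition map of an oriented diagram depends only on
the data in `SameDiagram` (`SameDiagram.Z_eq`), and that for the composition of `R` with a diagram
`A` in a disc `Δ` it depends on `A` only through the state sum of `A` (`glue_Zunshifted`), in which
a resolution of `A` is recorded by the way in which it joins the points of `∂Δ` and by the number
of its closed strands.

The invariance is then Kauffman's computation. The state sum of a kink is `q⁻¹` or `-q²` times that
of a strand; the state sum of two strands that cross twice is `-q` times that of two disjoint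
strands; and the state sums of the two triangles agree. Together with the signs of the crossings,
which are determined by the orientation outside `Δ`, this matches the normalisation by `q` for a
positive and `-q⁻²` for a negative crossing (`LocalMove.Z_eq`). Planarity plays no role.
-/

noncomputable section

namespace Tangle

/-! ### Classes of a relation that is extended along a map -/

section Classes

open Relation

/-- The number of classes of the equivalence relation generated by `r` that contain no point in the
image of `b`. -/
def freeClasses {S B : Type} (r : S → S → Prop) (b : B → S) : ℕ :=
  Nat.card {c : Quot r // ∀ x, Quot.mk r (b x) ≠ c}

theorem eqvGen_iff_mk_eq {S : Type} {r : S → S → Prop} {s t : S} :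
    EqvGen r s t ↔ Quot.mk r s = Quot.mk r t :=
  ⟨Quot.eqvGen_sound, Quot.eqvGen_exact⟩

theorem eqvGen_congr {S S' : Type} {r : S → S → Prop} {r' : S' → S' → Prop} (e : S ≃ S')
    (he : ∀ s t, r s t ↔ r' (e s) (e t)) (s t : S) : EqvGen r s t ↔ EqvGen r' (e s) (e t) := by
  rw [eqvGen_iff_mk_eq, eqvGen_iff_mk_eq]
  exact (Quot.congr (rb := r') e he).injective.eq_iff.symm

theorem freeClasses_congr {S S' B B' : Type} {r : S → S → Prop} {r' : S' → S' → Prop}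
    {b : B → S} {b' : B' → S'} (e : S ≃ S') (he : ∀ s t, r s t ↔ r' (e s) (e t))
    (ε : B ≃ B') (hb : ∀ x, b' (ε x) = e (b x)) : freeClasses r b = freeClasses r' b' := by
  refine Nat.card_congr ((Quot.congr e he).subtypeEquiv fun c => ?_)
  rw [← ε.forall_congr_right]
  refine forall_congr' fun x => not_congr ?_
  rw [hb]
  exact (Quot.congr (rb := r') e he).injective.eq_iff.symm

variable {S B : Type} {r h : S → S → Prop} {b : B → S} {r' g : B → B → Prop}

open Classical in
/-- Let `h` be generated by `r` and by the relations `g` between the images of points of `B`. Then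
a class of `h` either meets the image of `b`, and these classes are those of the relation on `B`
that is generated by `g` and the pullback `r'` of `r`, or it is a class of `r` that does not meet
the image of `b`. -/
def quotJoinEquiv (hr : ∀ x y, r' x y ↔ EqvGen r (b x) (b y))
    (hh : ∀ s t, h s t ↔ r s t ∨ Relation.Map g b b s t) :
    Quot h ≃ Quot (r' ⊔ g) ⊕ {c : Quot r // ∀ x, Quot.mk r (b x) ≠ c} :=
  let F : Quot r → Quot (r' ⊔ g) ⊕ {c : Quot r // ∀ x, Quot.mk r (b x) ≠ c} := fun c =>
    if hc : ∃ x, Quot.mk r (b x) = c then .inl (Quot.mk _ hc.choose)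
    else .inr ⟨c, fun x hx => hc ⟨x, hx⟩⟩
  have hF : ∀ x, F (Quot.mk r (b x)) = .inl (Quot.mk _ x) := fun x => by
    have hc : ∃ y, Quot.mk r (b y) = Quot.mk r (b x) := ⟨x, rfl⟩
    simp only [F, dif_pos hc]
    exact congrArg _ (Quot.sound (Or.inl ((hr _ _).2 (eqvGen_iff_mk_eq.2 hc.choose_spec))))
  have hF' : ∀ c : {c : Quot r // ∀ x, Quot.mk r (b x) ≠ c}, F c.1 = .inr c := fun c =>
    dif_neg fun ⟨x, hx⟩ => c.2 x hx
  { toFun := Quot.lift (fun s => F (Quot.mk r s)) fun s t hst => by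
      rcases (hh s t).1 hst with hst | ⟨x, y, hxy, rfl, rfl⟩
      · exact congrArg F (Quot.sound hst)
      · rw [hF, hF]
        exact congrArg _ (Quot.sound (Or.inr hxy))
    invFun := Sum.elim
      (Quot.lift (fun x => Quot.mk h (b x)) fun x y hxy => by
        rcases hxy with hxy | hxy
        · exact eqvGen_iff_mk_eq.1 (((hr x y).1 hxy).mono fun s t hst => (hh s t).2 (Or.inl hst))
        · exact Quot.sound ((hh _ _).2 (Or.inr ⟨x, y, hxy, rfl, rfl⟩)))
      fun c => Quot.lift (fun s => Quot.mk h s)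
        (fun s t hst => Quot.sound ((hh s t).2 (Or.inl hst))) c.1
    left_inv := by
      rintro ⟨s⟩
      change Sum.elim _ _ (F (Quot.mk r s)) = Quot.mk h s
      by_cases hc : ∃ x, Quot.mk r (b x) = Quot.mk r s
      · obtain ⟨x, hx⟩ := hc
        rw [← hx, hF]
        exact eqvGen_iff_mk_eq.1 ((eqvGen_iff_mk_eq.2 hx).mono
          fun s t hst => (hh s t).2 (Or.inl hst))
      · have := hF' ⟨Quot.mk r s, fun x hx => hc ⟨x, hx⟩⟩
        simp only at this
        rw [this]
        rfl
    right_inv := by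
      rintro (⟨⟨x⟩⟩ | ⟨⟨s⟩, hs⟩)
      · exact hF x
      · exact hF' ⟨_, hs⟩ }

theorem quotJoinEquiv_mk (hr : ∀ x y, r' x y ↔ EqvGen r (b x) (b y))
    (hh : ∀ s t, h s t ↔ r s t ∨ Relation.Map g b b s t) (x : B) :
    quotJoinEquiv hr hh (Quot.mk h (b x)) = .inl (Quot.mk _ x) :=
  ((quotJoinEquiv hr hh).eq_symm_apply).1 rfl

theorem eqvGen_join (hr : ∀ x y, r' x y ↔ EqvGen r (b x) (b y))
    (hh : ∀ s t, h s t ↔ r s t ∨ Relation.Map g b b s t) (x y : B) :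
    EqvGen h (b x) (b y) ↔ EqvGen (r' ⊔ g) x y := by
  rw [eqvGen_iff_mk_eq, eqvGen_iff_mk_eq, ← (quotJoinEquiv hr hh).injective.eq_iff,
    quotJoinEquiv_mk, quotJoinEquiv_mk, Sum.inl_injective.eq_iff]

theorem freeClasses_join [Finite S] [Finite B] (hr : ∀ x y, r' x y ↔ EqvGen r (b x) (b y))
    (hh : ∀ s t, h s t ↔ r s t ∨ Relation.Map g b b s t) {B' : Type} (j : B' → B) :
    freeClasses h (b ∘ j) = freeClasses (r' ⊔ g) j + freeClasses r b := by
  have e := (quotJoinEquiv hr hh).subtypeEquiv (p := fun c => ∀ x, Quot.mk h ((b ∘ j) x) ≠ c)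
    (q := fun c => ∀ x, .inl (Quot.mk _ (j x)) ≠ c) fun c => by
      refine forall_congr' fun x => not_congr ?_
      rw [← quotJoinEquiv_mk hr hh, (quotJoinEquiv hr hh).injective.eq_iff]
      rfl
  rw [freeClasses, freeClasses, freeClasses, Nat.card_congr (e.trans Equiv.subtypeSum),
    Nat.card_sum]
  congr 1
  · exact Nat.card_congr (Equiv.subtypeEquivRight fun c =>
      forall_congr' fun x => not_congr Sum.inl_injective.eq_iff)
  · exact Nat.card_congr (Equiv.subtypeUnivEquiv fun c x => by simp)

end Classes

/-! ### Planar diagrams -/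

section Planar

open Relation

variable {ι : Type} {n : Option ι → ℕ}

/-- The value `q + q⁻¹` of a circle that meets no boundary circle. -/
def loopValue : Coeff := LaurentPolynomial.T 2 + LaurentPolynomial.T (-2)

/-- The points on the boundary circles. -/
abbrev BdryPt (n : Option ι → ℕ) : Type := Σ d : Option ι, Fin (2 * n d)

/-- The end of an edge at a boundary point. -/
def bdrySlot {X V : Type} (x : BdryPt n) : Slot n X V := .bdry x.1 x.2

/-- The boundary points that are joined by an arc of the filling `f` in one of the discs `d ∈ F`. -/
def fillRel (f : Filling n) (F : Set (Option ι)) (x y : BdryPt n) : Prop :=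
  ∃ d ∈ F, ∃ j, x = ⟨d, j⟩ ∧ y = ⟨d, (f d).1 j⟩

/-- The boundary points that are joined by a strand of `P`. -/
def PlanarDiagram.bdryRel (P : PlanarDiagram n) (x y : BdryPt n) : Prop :=
  EqvGen P.Step (bdrySlot x) (bdrySlot y)

/-- The analogue of `PlanarDiagram.IsBoundary` for the relation `a` of being joined by a strand, and
signs for the classes of boundary points. -/
def IsRelBoundary (a : BdryPt n → BdryPt n → Prop) (f : Filling n)
    (σ : Quot (a ⊔ fillRel f Set.univ) → Bool) (d : Option ι) (L : CleavedLink (n d)) : Prop :=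
  L.near d = f d ∧
  (∀ j, EqvGen (a ⊔ fillRel f {d}ᶜ) ⟨d, j⟩ ⟨d, (L.far d).1 j⟩) ∧
  ∀ j, L.sign j = σ (Quot.mk _ ⟨d, j⟩)

/-- The number of boundary circles that meet a class of boundary points. -/
def relMeets (a : BdryPt n → BdryPt n → Prop) (f : Filling n)
    (C : Quot (a ⊔ fillRel f Set.univ)) : ℕ :=
  Nat.card {d : Option ι // ∃ j, Quot.mk _ ⟨d, j⟩ = C}

/-- The weight of a filling with signs, without the circles that meet no boundary circle. -/
def relWeight [Finite ι] (a : BdryPt n → BdryPt n → Prop) (f : Filling n)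
    (σ : Quot (a ⊔ fillRel f Set.univ) → Bool) : Coeff :=
  letI : Fintype (Quot (a ⊔ fillRel f Set.univ)) := Fintype.ofFinite _
  ∏ C, LaurentPolynomial.T
    (if σ C then 2 - (relMeets a f C : ℤ) else -2 + (relMeets a f C : ℤ))

open Classical in
/-- The coefficient of the partition map of a planar diagram without closed strands in which the
boundary points are joined according to `a`. -/
def relCoeff [Finite ι] (a : BdryPt n → BdryPt n → Prop)
    (L₀ : CleavedLink (n none)) (L : (i : ι) → CleavedLink (n (some i))) : Coeff :=
  letI : Fintype (Filling n) := Fintype.ofFinite _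
  letI (f : Filling n) : Fintype (Quot (a ⊔ fillRel f Set.univ) → Bool) := Fintype.ofFinite _
  ∑ f : Filling n, ∑ σ : Quot (a ⊔ fillRel f Set.univ) → Bool,
    if IsRelBoundary a f σ none L₀ ∧ ∀ i, IsRelBoundary a f σ (some i) (L i) then
      relWeight a f σ else 0

/-- The partition map of a planar diagram without closed strands in which the boundary points are
joined according to `a`. -/
def relZ [Finite ι] (a : BdryPt n → BdryPt n → Prop) :
    (⨂[Coeff] i : ι, CleavedModule (n (some i))) →ₗ[Coeff] CleavedModule (n none) :=
  letI : Fintype (CleavedLink (n none)) := Fintype.ofFinite _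
  (Basis.piTensorProduct fun i : ι =>
      (Finsupp.basisSingleOne : Module.Basis (CleavedLink (n (some i))) Coeff _)).constr Coeff
    fun L => ∑ L₀ : CleavedLink (n none), relCoeff a L₀ L • Finsupp.single L₀ (1 : Coeff)

theorem PlanarDiagram.fillStep_iff (P : PlanarDiagram n) (f : Filling n) (F : Set (Option ι))
    (s t : Slot n Empty P.V) :
    P.FillStep f F s t ↔ P.Step s t ∨ Relation.Map (fillRel f F) bdrySlot bdrySlot s t := by
  refine or_congr Iff.rfl ⟨?_, ?_⟩
  · rintro ⟨d, hd, j, rfl, rfl⟩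
    exact ⟨_, _, ⟨d, hd, j, rfl, rfl⟩, rfl, rfl⟩
  · rintro ⟨_, _, ⟨d, hd, j, rfl, rfl⟩, rfl, rfl⟩
    exact ⟨d, hd, j, rfl, rfl⟩

/-- The closed strands of a planar diagram. -/
abbrev PlanarDiagram.Loops (P : PlanarDiagram n) : Type :=
  {c : Quot P.Step // ∀ x : BdryPt n, Quot.mk P.Step (bdrySlot x) ≠ c}

/-- The circles of a filled planar diagram are those that meet a boundary circle and the closed
strands of the diagram. -/
def PlanarDiagram.circlesEquiv (P : PlanarDiagram n) (f : Filling n) :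
    P.Circles f ≃ Quot (P.bdryRel ⊔ fillRel f Set.univ) ⊕ P.Loops :=
  quotJoinEquiv (fun _ _ => Iff.rfl) (P.fillStep_iff f Set.univ)

theorem PlanarDiagram.circlesEquiv_circleAt (P : PlanarDiagram n) (f : Filling n) (d : Option ι)
    (j : Fin (2 * n d)) : P.circlesEquiv f (P.circleAt f d j) = .inl (Quot.mk _ ⟨d, j⟩) :=
  quotJoinEquiv_mk (fun _ _ => Iff.rfl) (P.fillStep_iff f Set.univ) ⟨d, j⟩

theorem PlanarDiagram.meets_inl (P : PlanarDiagram n) (f : Filling n)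
    (C : Quot (P.bdryRel ⊔ fillRel f Set.univ)) :
    P.meets f ((P.circlesEquiv f).symm (.inl C)) = relMeets P.bdryRel f C := by
  refine Nat.card_congr (Equiv.subtypeEquivRight fun d => exists_congr fun j => ?_)
  rw [Equiv.eq_symm_apply, P.circlesEquiv_circleAt, Sum.inl_injective.eq_iff]

theorem PlanarDiagram.meets_inr (P : PlanarDiagram n) (f : Filling n) (C : P.Loops) :
    P.meets f ((P.circlesEquiv f).symm (.inr C)) = 0 := by
  refine Nat.card_eq_zero.2 (Or.inl ⟨?_⟩)
  rintro ⟨d, j, hj⟩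
  rw [Equiv.eq_symm_apply, P.circlesEquiv_circleAt] at hj
  cases hj

/-- Signs for the circles of a filled diagram are signs for the circles that meet a boundary circle
and for the closed strands. -/
def PlanarDiagram.signEquiv (P : PlanarDiagram n) (f : Filling n) :
    (P.Circles f → Bool) ≃
      (Quot (P.bdryRel ⊔ fillRel f Set.univ) → Bool) × (P.Loops → Bool) :=
  (Equiv.arrowCongr (P.circlesEquiv f) (Equiv.refl Bool)).trans
    (Equiv.sumArrowEquivProdArrow _ _ _)

theorem PlanarDiagram.isBoundary_iff (P : PlanarDiagram n) (f : Filling n)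
    (σ : P.Circles f → Bool) (d : Option ι) (L : CleavedLink (n d)) :
    P.IsBoundary ⟨f, σ⟩ d L ↔ IsRelBoundary P.bdryRel f (P.signEquiv f σ).1 d L := by
  refine and_congr Iff.rfl (and_congr (forall_congr' fun j => ?_) (forall_congr' fun j => ?_))
  · exact eqvGen_join (b := bdrySlot) (r' := P.bdryRel) (fun _ _ => Iff.rfl)
      (P.fillStep_iff f {d}ᶜ) ⟨d, j⟩ ⟨d, _⟩
  · change _ ↔ _ = σ ((P.circlesEquiv f).symm (.inl _))
    rw [← P.circlesEquiv_circleAt, Equiv.symm_apply_apply]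

/-- The closed strands meet no boundary circle, so they contribute `q` or `q⁻¹` each. -/
theorem PlanarDiagram.weight_eq [Finite ι] (P : PlanarDiagram n) (f : Filling n)
    (σ : P.Circles f → Bool) [Fintype P.Loops] :
    P.weight ⟨f, σ⟩ = relWeight P.bdryRel f (P.signEquiv f σ).1 *
      ∏ C, LaurentPolynomial.T (if (P.signEquiv f σ).2 C then 2 else -2) := by
  let : Fintype (P.Circles f) := Fintype.ofFinite _
  let : Fintype (Quot (P.bdryRel ⊔ fillRel f Set.univ)) := Fintype.ofFinite _
  unfold PlanarDiagram.weight relWeight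
  rw [← Equiv.prod_comp (P.circlesEquiv f).symm, Fintype.prod_sum_type]
  congr 1
  · refine Fintype.prod_congr _ _ fun C => ?_
    simp only [P.meets_inl]
    rfl
  · refine Fintype.prod_congr _ _ fun C => ?_
    simp only [P.meets_inr]
    rfl

theorem sum_prod_sign {α : Type} [Fintype α] [DecidableEq α] :
    ∑ σ : α → Bool, ∏ C, (LaurentPolynomial.T (if σ C then 2 else -2) : Coeff) =
      loopValue ^ Nat.card α := by
  have := Finset.prod_univ_sum (fun _ : α => (Finset.univ : Finset Bool))
    (fun _ s => (LaurentPolynomial.T (if s then 2 else -2) : Coeff))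
  rw [Fintype.piFinset_univ] at this
  rw [← this]
  simp [loopValue, Nat.card_eq_fintype_card]

/-- The signs of the closed strands are independent of everything else. -/
theorem PlanarDiagram.coeff_eq [Finite ι] (P : PlanarDiagram n) (L₀ : CleavedLink (n none))
    (L : (i : ι) → CleavedLink (n (some i))) :
    P.coeff L₀ L = loopValue ^ freeClasses P.Step bdrySlot * relCoeff P.bdryRel L₀ L := by
  classical
  let : Fintype (Filling n) := Fintype.ofFinite _
  let (f : Filling n) : Fintype (P.Circles f → Bool) := Fintype.ofFinite _
  let (f : Filling n) : Fintype (Quot (P.bdryRel ⊔ fillRel f Set.univ) → Bool) :=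
    Fintype.ofFinite _
  let : Fintype P.Loops := Fintype.ofFinite _
  have h₁ : P.coeff L₀ L = ∑ f : Filling n, ∑ σ : P.Circles f → Bool,
      if P.IsBoundary ⟨f, σ⟩ none L₀ ∧ ∀ i, P.IsBoundary ⟨f, σ⟩ (some i) (L i) then
        P.weight ⟨f, σ⟩ else 0 := by
    rw [← Fintype.sum_sigma (fun M : Σ f : Filling n, (P.Circles f → Bool) =>
      if P.IsBoundary ⟨M.1, M.2⟩ none L₀ ∧ ∀ i, P.IsBoundary ⟨M.1, M.2⟩ (some i) (L i) then
        P.weight ⟨M.1, M.2⟩ else 0)]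
    unfold PlanarDiagram.coeff
    exact @Fintype.sum_equiv _ _ _ (_) (_) _ (Equiv.refl _) _ _ fun _ => by congr
  rw [h₁, relCoeff, Finset.mul_sum]
  refine Fintype.sum_congr _ _ fun f => ?_
  rw [← Equiv.sum_comp (P.signEquiv f).symm, Fintype.sum_prod_type, Finset.mul_sum]
  refine Fintype.sum_congr _ _ fun σ => ?_
  simp only [P.isBoundary_iff, P.weight_eq, Equiv.apply_symm_apply]
  split_ifs with h
  · rw [← Finset.mul_sum, sum_prod_sign, mul_comm]
    rfl
  · simp

/-- The partition map of a planar diagram depends only on the way in which the strands join the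
boundary points and on the number of closed strands. -/
theorem PlanarDiagram.Z_eq [Finite ι] (P : PlanarDiagram n) :
    P.Z = loopValue ^ freeClasses P.Step bdrySlot • relZ P.bdryRel := by
  rw [PlanarDiagram.Z, relZ, ← map_smul]
  congr 1
  funext L
  simp only [Pi.smul_apply, Finset.smul_sum, smul_smul, P.coeff_eq]

end Planar

/-! ### Resolutions of a diagram -/

section Resolved

open Relation

variable {ι : Type} {n : Option ι → ℕ} {X : Type}

/-- The end at a crossing to which the end `k` is joined in the `r`-smoothing. -/
def partner (r : Bool) (k : Fin 4) : Fin 4 :=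
  smoothing r (((smoothing r).symm k).1, !((smoothing r).symm k).2)

theorem partner_add_two (r : Bool) (k : Fin 4) : partner r (k + 2) = partner r k + 2 := by
  revert r k; decide

theorem partner_smoothing (r a b : Bool) :
    partner r (smoothing r (a, b)) = smoothing r (a, !b) := by
  simp [partner]

/-- The terminals of the strands: the ends at the crossings and the boundary points. -/
abbrev Terminal (n : Option ι → ℕ) (X : Type) : Type := (X × Fin 4) ⊕ BdryPt n

/-- The end of an edge at a terminal. -/
def terminalSlot {V : Type} : Terminal n X → Slot n X V
  | .inl (x, k) => .cross x k
  | .inr x => bdrySlot x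

/-- The terminals that are joined at the crossings by the smoothings `ρ`. -/
def crossRel (ρ : X → Bool) (a b : Terminal n X) : Prop :=
  ∃ x k, a = .inl (x, k) ∧ b = .inl (x, partner (ρ x) k)

/-- The terminals that are joined by a strand of `D`. -/
def Diagram.strandRel (D : Diagram n X) (a b : Terminal n X) : Prop :=
  EqvGen D.Step (terminalSlot a) (terminalSlot b)

/-- Adjacency along the strands of the resolution `ρ`, for the ends of the edges of `D`. -/
def Diagram.resolvedStep (D : Diagram n X) (ρ : X → Bool) (s t : Slot n X D.V) : Prop :=
  D.Step s t ∨ Relation.Map (crossRel ρ) terminalSlot terminalSlot s t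

theorem map_crossRel_iff {V : Type} (ρ : X → Bool) (s t : Slot n X V) :
    Relation.Map (crossRel ρ) terminalSlot terminalSlot s t ↔
      ∃ x k, s = .cross x k ∧ t = .cross x (partner (ρ x) k) := by
  constructor
  · rintro ⟨_, _, ⟨x, k, rfl, rfl⟩, rfl, rfl⟩
    exact ⟨x, k, rfl, rfl⟩
  · rintro ⟨x, k, rfl, rfl⟩
    exact ⟨_, _, ⟨x, k, rfl, rfl⟩, rfl, rfl⟩

theorem Diagram.resolvedStep_iff (D : Diagram n X) (ρ : X → Bool) (s t : Slot n X D.V) :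
    D.resolvedStep ρ s t ↔ t = D.edge s ∨ (∃ v b, s = .mark v b ∧ t = .mark v (!b)) ∨
      ∃ x k, s = .cross x k ∧ t = .cross x (partner (ρ x) k) :=
  (or_congr Iff.rfl (map_crossRel_iff ρ s t)).trans or_assoc

theorem Diagram.resolve_step_iff [Finite X] (D : Diagram n X) (ρ : X → Bool)
    (s t : Slot n Empty (D.V ⊕ X × Bool)) :
    (D.resolve ρ).Step s t ↔ D.resolvedStep ρ (resolveSlot ρ s) (resolveSlot ρ t) := by
  rw [Diagram.resolvedStep_iff]
  refine or_congr (Equiv.eq_symm_apply _) ⟨?_, ?_⟩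
  · rintro ⟨v | ⟨x, a⟩, b, rfl, rfl⟩
    · exact Or.inl ⟨v, b, rfl, rfl⟩
    · exact Or.inr ⟨x, _, rfl, by rw [partner_smoothing]; rfl⟩
  · rintro (⟨v, b, hs, ht⟩ | ⟨x, k, hs, ht⟩)
    · rw [← Equiv.eq_symm_apply] at hs ht
      exact ⟨.inl v, b, hs, ht⟩
    · rw [← Equiv.eq_symm_apply] at hs ht
      refine ⟨.inr (x, ((smoothing (ρ x)).symm k).1), _, hs, ht.trans ?_⟩
      simp only [resolveSlot, partner, Equiv.coe_fn_symm_mk, Equiv.symm_apply_apply]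
      rfl

theorem Diagram.resolve_Z [Finite ι] [Finite X] (D : Diagram n X) (ρ : X → Bool) :
    (D.resolve ρ).Z = loopValue ^ freeClasses (D.resolvedStep ρ) bdrySlot •
      relZ fun x y => EqvGen (D.resolvedStep ρ) (bdrySlot x) (bdrySlot y) := by
  rw [PlanarDiagram.Z_eq]
  congr 2
  · exact freeClasses_congr (resolveSlot ρ) (D.resolve_step_iff ρ) (Equiv.refl _) fun _ => rfl
  · funext x y
    exact propext (eqvGen_congr (resolveSlot ρ) (D.resolve_step_iff ρ) _ _)

instance [Finite ι] (V : Type) [Finite X] [Finite V] : Finite (Slot n X V) :=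
  Finite.of_equiv _ (resolveSlot fun _ => false)

theorem Diagram.numLoops_eq (D : Diagram n X) :
    D.numLoops = freeClasses D.Step terminalSlot := by
  refine Nat.card_congr (Equiv.subtypeEquivRight fun c => ?_)
  rw [Sum.forall, Prod.forall, Sigma.forall]
  rfl

/-- The strands of the resolution `ρ` are determined by the way in which the strands of `D` join
the terminals, and by the number of closed strands of `D`. -/
theorem Diagram.resolve_Z_eq_state [Finite ι] [Finite X] (D : Diagram n X) (ρ : X → Bool) :
    (D.resolve ρ).Z =
      loopValue ^ (freeClasses (D.strandRel ⊔ crossRel ρ) Sum.inr + D.numLoops) •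
        relZ fun x y => EqvGen (D.strandRel ⊔ crossRel ρ) (.inr x) (.inr y) := by
  rw [D.resolve_Z, D.numLoops_eq]
  congr 2
  · exact freeClasses_join (b := terminalSlot) (r' := D.strandRel) (fun _ _ => Iff.rfl)
      (fun _ _ => Iff.rfl) Sum.inr
  · funext x y
    exact propext (eqvGen_join (b := terminalSlot) (r' := D.strandRel) (fun _ _ => Iff.rfl)
      (fun _ _ => Iff.rfl) (.inr x) (.inr y))

end Resolved

/-! ### Invariance under a change of presentation -/

section Same

open Relation

variable {ι : Type} {n : Option ι → ℕ} {X X' : Type} {D : Diagram n X} {D' : Diagram n X'}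

open Classical in
/-- The contribution `q` of a positive and `-q⁻²` of a negative crossing to the normalisation. -/
def crossingWeight (o : StrandOrientation D) (x : X) : Coeff :=
  if o.IsPositive x then LaurentPolynomial.T 2 else -LaurentPolynomial.T (-4)

theorem crossingWeight_congr {n' : Option ι → ℕ} {D' : Diagram n' X'} {o : StrandOrientation D}
    {o' : StrandOrientation D'} {x : X} {x' : X'} (h : o.IsPositive x ↔ o'.IsPositive x') :
    crossingWeight o x = crossingWeight o' x' := by
  classical exact if_congr h rfl rfl

/-- The normalised partition map of an oriented diagram. -/
def StrandOrientation.Z [Finite ι] [Fintype X] [DecidableEq X] (o : StrandOrientation D) :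
    (⨂[Coeff] i : ι, CleavedModule (n (some i))) →ₗ[Coeff] CleavedModule (n none) :=
  (∏ x, crossingWeight o x) • D.Zunshifted

theorem TangleDiagram.Z_eq [Finite ι] {𝔻 : DiscConfig ι} (T : TangleDiagram 𝔻 n) :
    T.Z = T.orient.Z := by
  classical
  rw [TangleDiagram.Z, StrandOrientation.Z]
  congr 1
  simp only [crossingWeight, Finset.prod_ite, Finset.prod_const]
  rw [TangleDiagram.nPos, TangleDiagram.nNeg, Nat.card_eq_fintype_card, Nat.card_eq_fintype_card,
    Fintype.card_subtype, Fintype.card_subtype, neg_pow (LaurentPolynomial.T (-4) : Coeff),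
    LaurentPolynomial.T_pow, LaurentPolynomial.T_pow, mul_left_comm, ← LaurentPolynomial.T_add]
  congr 2
  ring

/-- The bijection of terminals given by a renaming of the crossings and rotations by `2`. -/
def terminalEquiv (e : X ≃ X') (r : X → Bool) : Terminal n X ≃ Terminal n X' :=
  Equiv.sumCongr
    ((Equiv.prodShear e fun x => if r x then Equiv.addRight 2 else Equiv.refl (Fin 4)))
    (Equiv.refl _)

theorem mapSlot_fst {V V' : Type} (e : X ≃ X') (r : X → Bool) (a : Terminal n X) :
    (mapSlot (V := V) (V' := V') e r a).1 = terminalSlot a := by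
  rcases a with ⟨x, k⟩ | ⟨d, j⟩ <;> rfl

theorem mapSlot_snd {V V' : Type} (e : X ≃ X') (r : X → Bool) (a : Terminal n X) :
    (mapSlot (V := V) (V' := V') e r a).2 = terminalSlot (terminalEquiv e r a) := by
  rcases a with ⟨x, k⟩ | ⟨d, j⟩
  · cases h : r x <;> simp [mapSlot, terminalEquiv, terminalSlot, h]
  · rfl

/-- The smoothings do not change when the numbering of the ends at a crossing is rotated by `2`. -/
theorem crossRel_iff (e : X ≃ X') (r : X → Bool) (ρ : X' → Bool) (a b : Terminal n X) :
    crossRel (ρ ∘ e) a b ↔ crossRel ρ (terminalEquiv e r a) (terminalEquiv e r b) := by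
  have key : ∀ x k, terminalEquiv (n := n) e r (.inl (x, partner (ρ (e x)) k)) =
      .inl (e x, partner (ρ (e x)) (if r x then k + 2 else k)) := fun x k => by
    cases h : r x <;> simp [terminalEquiv, h, partner_add_two]
  have key' : ∀ x k, terminalEquiv (n := n) e r (.inl (x, k)) =
      .inl (e x, if r x then k + 2 else k) := fun x k => by
    cases h : r x <;> simp [terminalEquiv, h]
  constructor
  · rintro ⟨x, k, rfl, rfl⟩
    exact ⟨e x, _, key' x k, key x k⟩
  · rintro ⟨x', k', ha, hb⟩
    rcases a with ⟨x, k⟩ | a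
    · rw [key'] at ha
      obtain ⟨rfl, rfl⟩ := Prod.mk.inj (Sum.inl.inj ha)
      refine ⟨x, k, rfl, ?_⟩
      rw [← key] at hb
      exact (terminalEquiv e r).injective hb
    · cases ha

theorem SameDiagram.Z_eq [Finite ι] [Fintype X] [DecidableEq X] [Fintype X'] [DecidableEq X']
    {o : StrandOrientation D} {o' : StrandOrientation D'} (h : SameDiagram o o') : o.Z = o'.Z := by
  obtain ⟨e, r, hrel, hloops, hout⟩ := h
  simp only [mapSlot_fst, mapSlot_snd] at hrel hout
  unfold StrandOrientation.Z
  congr 1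
  · refine Fintype.prod_equiv e _ _ fun x => ?_
    have h0 := hout (.inl (x, 0))
    have h1 := hout (.inl (x, 1))
    have h2 := o'.out_cross (e x) 0
    have h3 := o'.out_cross (e x) 1
    have : o.IsPositive x ↔ o'.IsPositive (e x) := by
      unfold StrandOrientation.IsPositive
      cases hr : r x <;>
        simp only [terminalSlot, terminalEquiv, Equiv.sumCongr_apply, Sum.map_inl,
          Equiv.prodShear_apply, hr, Bool.false_eq_true, if_false, if_true, Equiv.refl_apply,
          Equiv.coe_addRight] at h0 h1
      · rw [h0, h1]
      · rw [h0, h1, h2, h3]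
        simp
    exact crossingWeight_congr this
  · refine Fintype.sum_equiv (Equiv.arrowCongr e (Equiv.refl Bool)) _ _ fun ρ => ?_
    obtain ⟨ρ, rfl⟩ : ∃ ρ', ρ' ∘ e = ρ := ⟨ρ ∘ e.symm, by ext; simp⟩
    have hρ : Equiv.arrowCongr e (Equiv.refl Bool) (ρ ∘ e) = ρ := by ext; simp
    have hstate : ∀ a b, (D.strandRel ⊔ crossRel (ρ ∘ e)) a b ↔
        (D'.strandRel ⊔ crossRel ρ) (terminalEquiv e r a) (terminalEquiv e r b) := fun a b =>
      or_congr (hrel a b) (crossRel_iff e r ρ a b)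
    rw [hρ]
    refine congrArg₂ (· • ·) (congrArg ((-LaurentPolynomial.T 2 : Coeff) ^ ·) ?_) ?_
    · exact Equiv.sum_comp e fun x => if ρ x then 1 else 0
    · rw [D.resolve_Z_eq_state, D'.resolve_Z_eq_state, hloops,
        freeClasses_congr (terminalEquiv e r) hstate (Equiv.refl _) (b' := Sum.inr) fun _ => rfl]
      congr 2
      funext x y
      exact propext (eqvGen_congr (terminalEquiv e r) hstate _ _)

end Same

/-! ### Gluing a diagram into a disc -/

section Glue

open Relation

variable {ι : Type} {n : Option ι → ℕ} {X X' : Type} {k : ℕ}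

/-- The ends of the edges outside a disc `Δ`, and the points on its boundary, embedded into the ends
of the edges of both parts of a diagram that is composed along the boundary of `Δ`. -/
def outerSlot {V V' : Type} (s : Slot (addDisc n k) X V ⊕ Fin (2 * k)) :
    Slot (addDisc n k) X V ⊕ Slot (oneDisc k) X' V' :=
  Sum.map id (fun j => .bdry none j) s

/-- Adjacency outside `Δ` in the resolution `ρ`, and of the ends at the boundary of `Δ` with the
corresponding points. -/
def outerRel (R : Diagram (addDisc n k) X) (ρ : X → Bool) :
    Slot (addDisc n k) X R.V ⊕ Fin (2 * k) → Slot (addDisc n k) X R.V ⊕ Fin (2 * k) → Prop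
  | .inl s, .inl t => R.resolvedStep ρ s t
  | .inl s, .inr j => s = .bdry (some none) j
  | .inr j, .inl t => t = .bdry (some none) j
  | .inr _, .inr _ => False

/-- `glueSlot`, for the ends of the edges of the composed diagram. -/
def glueEquiv (R : Diagram (addDisc n k) X) (A : Diagram (oneDisc k) X') :
    Slot n (X ⊕ X') (glue R A).V ≃ Slot (addDisc n k) X R.V ⊕ Slot (oneDisc k) X' A.V :=
  glueSlot

theorem glue_edge_symm (R : Diagram (addDisc n k) X) (A : Diagram (oneDisc k) X')
    (s : Slot (addDisc n k) X R.V ⊕ Slot (oneDisc k) X' A.V) :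
    (glue R A).edge ((glueEquiv R A).symm s) = (glueEquiv R A).symm (Sum.map R.edge A.edge s) :=
  congrArg (fun s => (glueEquiv R A).symm (Sum.map R.edge A.edge s)) (Equiv.apply_symm_apply _ _)

theorem glue_resolvedStep_iff (R : Diagram (addDisc n k) X) (A : Diagram (oneDisc k) X')
    (ρ : X → Bool) (ρ' : X' → Bool)
    (s t : Slot (addDisc n k) X R.V ⊕ Slot (oneDisc k) X' A.V) :
    (glue R A).resolvedStep (Sum.elim ρ ρ') ((glueEquiv R A).symm s) ((glueEquiv R A).symm t) ↔
      Sum.LiftRel (fun _ _ => False) (A.resolvedStep ρ') s t ∨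
        Relation.Map (outerRel R ρ) outerSlot outerSlot s t := by
  have hout : Relation.Map (outerRel R ρ) outerSlot outerSlot s t ↔
      (∃ s' t', R.resolvedStep ρ s' t' ∧ s = .inl s' ∧ t = .inl t') ∨
      (∃ j, s = .inl (.bdry (some none) j) ∧ t = .inr (.bdry none j)) ∨
      (∃ j, s = .inr (.bdry none j) ∧ t = .inl (.bdry (some none) j)) := by
    constructor
    · rintro ⟨s | j, t | j', h, rfl, rfl⟩
      · exact Or.inl ⟨s, t, h, rfl, rfl⟩
      · obtain rfl : s = _ := h
        exact Or.inr (Or.inl ⟨j', rfl, rfl⟩)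
      · obtain rfl : t = _ := h
        exact Or.inr (Or.inr ⟨j, rfl, rfl⟩)
      · exact h.elim
    · rintro (⟨s, t, h, rfl, rfl⟩ | ⟨j, rfl, rfl⟩ | ⟨j, rfl, rfl⟩)
      · exact ⟨.inl s, .inl t, h, rfl, rfl⟩
      · exact ⟨.inl (.bdry (some none) j), .inr j, rfl, rfl, rfl⟩
      · exact ⟨.inr j, .inl (.bdry (some none) j), rfl, rfl, rfl⟩
  rw [hout]
  refine ((glue R A).resolvedStep_iff _ _ _).trans ?_
  rw [glue_edge_symm, EmbeddingLike.apply_eq_iff_eq]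
  constructor
  · rintro (rfl | ⟨v | v | j, b, hs, ht⟩ | ⟨x | x, a, hs, ht⟩)
    · rcases s with s | s
      · exact Or.inr (Or.inl ⟨s, _, Or.inl (Or.inl rfl), rfl, rfl⟩)
      · exact Or.inl (Sum.LiftRel.inr (Or.inl (Or.inl rfl)))
    all_goals rw [Equiv.symm_apply_eq] at hs ht; subst hs ht
    · exact Or.inr (Or.inl ⟨_, _, Or.inl (Or.inr ⟨v, b, rfl, rfl⟩), rfl, rfl⟩)
    · exact Or.inl (Sum.LiftRel.inr (Or.inl (Or.inr ⟨v, b, rfl, rfl⟩)))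
    · cases b
      · exact Or.inr (Or.inr (Or.inl ⟨j, rfl, rfl⟩))
      · exact Or.inr (Or.inr (Or.inr ⟨j, rfl, rfl⟩))
    · exact Or.inr (Or.inl ⟨_, _, (R.resolvedStep_iff _ _ _).2 (Or.inr (Or.inr ⟨x, a, rfl, rfl⟩)),
        rfl, rfl⟩)
    · exact Or.inl (Sum.LiftRel.inr
        ((A.resolvedStep_iff _ _ _).2 (Or.inr (Or.inr ⟨x, a, rfl, rfl⟩))))
  · rintro (h | ⟨s, t, h, rfl, rfl⟩ | ⟨j, rfl, rfl⟩ | ⟨j, rfl, rfl⟩)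
    · rcases h with ⟨h⟩ | ⟨h⟩
      · exact h.elim
      · rcases (A.resolvedStep_iff _ _ _).1 h with rfl | ⟨v, b, rfl, rfl⟩ | ⟨x, a, rfl, rfl⟩
        · exact Or.inl rfl
        · exact Or.inr (Or.inl ⟨.inr (.inl v), b, rfl, rfl⟩)
        · exact Or.inr (Or.inr ⟨.inr x, a, rfl, rfl⟩)
    · rcases (R.resolvedStep_iff _ _ _).1 h with rfl | ⟨v, b, rfl, rfl⟩ | ⟨x, a, rfl, rfl⟩
      · exact Or.inl rfl
      · exact Or.inr (Or.inl ⟨.inl v, b, rfl, rfl⟩)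
      · exact Or.inr (Or.inr ⟨.inl x, a, rfl, rfl⟩)
    · exact Or.inr (Or.inl ⟨.inr (.inr j), false, rfl, rfl⟩)
    · exact Or.inr (Or.inl ⟨.inr (.inr j), true, rfl, rfl⟩)

theorem eqvGen_liftRel_iff {α β γ : Type} (r : β → β → Prop) (f : γ → β) (x y : α ⊕ γ) :
    Sum.LiftRel (· = ·) (fun i j => EqvGen r (f i) (f j)) x y ↔
      EqvGen (Sum.LiftRel (fun _ _ : α => False) r) (Sum.map id f x) (Sum.map id f y) := by
  have key : ∀ s t : α ⊕ β, EqvGen (Sum.LiftRel (fun _ _ : α => False) r) s t →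
      Sum.LiftRel (· = ·) (EqvGen r) s t := fun s t h => by
    induction h with
    | rel s t h =>
      rcases h with ⟨h⟩ | ⟨h⟩
      · exact h.elim
      · exact .inr (.rel _ _ h)
    | refl s => rcases s with s | s; exacts [.inl rfl, .inr (.refl _)]
    | symm s t _ h =>
      rcases h with ⟨h⟩ | ⟨h⟩
      exacts [.inl h.symm, .inr h.symm]
    | trans s t u _ _ h h' =>
      rcases h with ⟨h⟩ | ⟨h⟩ <;> rcases h' with ⟨h'⟩ | ⟨h'⟩
      exacts [.inl (h.trans h'), .inr (h.trans _ _ _ h')]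
  constructor
  · rintro (⟨rfl⟩ | ⟨h⟩)
    · exact .refl _
    · change EqvGen _ (Sum.inr _) (Sum.inr _)
      generalize f _ = s at h
      generalize f _ = t at h
      induction h with
      | rel s t h => exact .rel _ _ (.inr h)
      | refl s => exact .refl _
      | symm s t _ h => exact h.symm
      | trans s t u _ _ h h' => exact h.trans _ _ _ h'
  · intro h
    have := key _ _ h
    rcases x with x | x <;> rcases y with y | y <;> simp_all

/-- Adding points that are related to nothing, and that all lie in the image of the map, creates no
free classes. -/
theorem freeClasses_liftRel {α β γ : Type} (r : β → β → Prop) (f : γ → β) :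
    freeClasses (Sum.LiftRel (fun _ _ : α => False) r) (Sum.map id f) = freeClasses r f := by
  have h : ∀ s t, EqvGen (Sum.LiftRel (fun _ _ : α => False) r) (.inr s) (.inr t) ↔
      EqvGen r s t := fun s t => by
    have := eqvGen_liftRel_iff (α := α) r id (.inr s) (.inr t)
    simpa using this.symm
  symm
  refine Nat.card_congr (Equiv.ofBijective (fun c => ⟨Quot.map Sum.inr (fun _ _ h => .inr h) c.1,
    ?_⟩) ⟨?_, ?_⟩)
  · obtain ⟨⟨s⟩, hs⟩ := c
    rintro (a | x) hx
    · have := (eqvGen_liftRel_iff r id (.inl a) (.inr s)).2 (by simpa using eqvGen_iff_mk_eq.2 hx)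
      cases this
    · exact hs x (eqvGen_iff_mk_eq.1 ((h _ _).1 (eqvGen_iff_mk_eq.2 hx)))
  · rintro ⟨⟨s⟩, hs⟩ ⟨⟨t⟩, ht⟩ hst
    exact Subtype.ext (eqvGen_iff_mk_eq.1 ((h _ _).1 (eqvGen_iff_mk_eq.2 (congrArg Subtype.val hst))))
  · rintro ⟨⟨a | s⟩, hs⟩
    · exact (hs (.inl a) rfl).elim
    · refine ⟨⟨Quot.mk _ s, fun x hx => hs (.inr x) ?_⟩, rfl⟩
      exact eqvGen_iff_mk_eq.1 ((h _ _).2 (eqvGen_iff_mk_eq.2 hx))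

/-- The boundary points of the composed diagram, among the ends outside `Δ`. -/
def outerBdry {V : Type} (x : BdryPt n) : Slot (addDisc n k) X V ⊕ Fin (2 * k) :=
  .inl (match x with
    | ⟨none, j⟩ => .bdry none j
    | ⟨some i, j⟩ => .bdry (some (some i)) j)

/-- The partition map of the resolution `ρ` of `R`, with the points on the boundary of `Δ` joined
according to the relation `a`. -/
def outerZ [Finite ι] (R : Diagram (addDisc n k) X) (ρ : X → Bool)
    (a : Fin (2 * k) → Fin (2 * k) → Prop) :
    (⨂[Coeff] i : ι, CleavedModule (n (some i))) →ₗ[Coeff] CleavedModule (n none) :=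
  loopValue ^ freeClasses (Sum.LiftRel (· = ·) a ⊔ outerRel R ρ) outerBdry •
    relZ fun x y => EqvGen (Sum.LiftRel (· = ·) a ⊔ outerRel R ρ) (outerBdry x) (outerBdry y)

/-- The way in which the strands of the resolution `ρ` of a diagram in a disc join its boundary
points. -/
def discRel (A : Diagram (oneDisc k) X) (ρ : X → Bool) (i j : Fin (2 * k)) : Prop :=
  EqvGen (A.resolvedStep ρ) (.bdry none i) (.bdry none j)

/-- The number of closed strands of the resolution `ρ` of a diagram in a disc. -/
def discLoops (A : Diagram (oneDisc k) X) (ρ : X → Bool) : ℕ :=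
  freeClasses (A.resolvedStep ρ) fun j : Fin (2 * k) => .bdry none j

/-- The strands of `A` are resolved first, which leaves the points on the boundary of `Δ` joined by
`discRel A ρ'`; then the outer part is added by `outerRel R ρ`. -/
theorem glue_resolve_Z [Finite ι] [Finite X] [Finite X'] (R : Diagram (addDisc n k) X)
    (A : Diagram (oneDisc k) X') (ρ : X → Bool) (ρ' : X' → Bool) :
    ((glue R A).resolve (Sum.elim ρ ρ')).Z =
      loopValue ^ discLoops A ρ' • outerZ R ρ (discRel A ρ') := by
  have hbdry : ∀ x : BdryPt n, outerSlot (outerBdry x) =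
      glueEquiv R A (bdrySlot x) := by
    rintro ⟨_ | i, j⟩ <;> rfl
  have hstep := fun s t => (glue_resolvedStep_iff R A ρ ρ' ((glueEquiv R A) s) ((glueEquiv R A) t))
  simp only [Equiv.symm_apply_apply] at hstep
  rw [Diagram.resolve_Z, outerZ, smul_smul, ← pow_add]
  have hrel := eqvGen_liftRel_iff (α := Slot (addDisc n k) X R.V) (A.resolvedStep ρ')
    (fun j : Fin (2 * k) => Slot.bdry none j)
  congr 2
  · rw [freeClasses_congr (r' := fun s t => _ ∨ _) (glueEquiv R A) hstep (Equiv.refl _)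
      (b' := outerSlot ∘ outerBdry) hbdry]
    refine (freeClasses_join (b := outerSlot) hrel (fun _ _ => Iff.rfl) outerBdry).trans ?_
    rw [add_comm]
    congr 1
    exact freeClasses_liftRel _ _
  · funext x y
    refine propext ((eqvGen_congr (r' := fun s t => _ ∨ _) (glueEquiv R A) hstep _ _).trans ?_)
    rw [← hbdry, ← hbdry]
    exact eqvGen_join (b := outerSlot) hrel (fun _ _ => Iff.rfl) _ _

/-- The state sum of a diagram in a disc, for a function `W` of the way in which the boundary points
of the disc are joined. -/
def bracket {M : Type} [AddCommGroup M] [Module Coeff M] [Fintype X]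
    [DecidableEq X] (A : Diagram (oneDisc k) X) (W : (Fin (2 * k) → Fin (2 * k) → Prop) → M) : M :=
  ∑ ρ : X → Bool, (-LaurentPolynomial.T 2 : Coeff) ^ (∑ x, if ρ x then 1 else 0) •
    loopValue ^ discLoops A ρ • W (discRel A ρ)

theorem glue_Zunshifted [Finite ι] [Fintype X] [DecidableEq X] [Fintype X'] [DecidableEq X']
    (R : Diagram (addDisc n k) X) (A : Diagram (oneDisc k) X') :
    (glue R A).Zunshifted = ∑ ρ : X → Bool,
      (-LaurentPolynomial.T 2 : Coeff) ^ (∑ x, if ρ x then 1 else 0) •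
        bracket A (outerZ R ρ) := by
  rw [Diagram.Zunshifted, ← (Equiv.sumArrowEquivProdArrow X X' Bool).symm.sum_comp,
    Fintype.sum_prod_type]
  refine Fintype.sum_congr _ _ fun ρ => ?_
  rw [bracket, Finset.smul_sum]
  refine Fintype.sum_congr _ _ fun ρ' => ?_
  rw [smul_smul, ← pow_add]
  congr 1
  · rw [Fintype.sum_sum_type]
    rfl
  · exact glue_resolve_Z R A ρ ρ'

/-- Two diagrams in a disc may be exchanged if their state sums agree up to the contributions of
their crossings to the normalisation. -/
theorem glue_Z_congr [Finite ι] [Fintype X] [DecidableEq X] {c c' : ℕ}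
    {R : Diagram (addDisc n k) X} {A : Diagram (oneDisc k) (Fin c)} {B : Diagram (oneDisc k) (Fin c')}
    (o₁ : StrandOrientation (glue R A)) (o₂ : StrandOrientation (glue R B))
    (ho : ∀ s, o₁.out (glueSlot.symm (.inl s)) = o₂.out (glueSlot.symm (.inl s)))
    (h : ∀ ρ : X → Bool, (∏ x, crossingWeight o₁ (.inr x)) • bracket A (outerZ R ρ) =
      (∏ x, crossingWeight o₂ (.inr x)) • bracket B (outerZ R ρ)) :
    o₁.Z = o₂.Z := by
  have hX : ∀ x, crossingWeight o₁ (.inl x) = crossingWeight o₂ (.inl x) := fun x => by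
    have h0 := ho (.cross x 0)
    have h1 := ho (.cross x 1)
    have : o₁.IsPositive (.inl x) ↔ o₂.IsPositive (.inl x) := not_congr (h0 ▸ h1 ▸ Iff.rfl)
    exact crossingWeight_congr this
  simp only [StrandOrientation.Z, Fintype.prod_sum_type, glue_Zunshifted, Finset.smul_sum, hX]
  refine Fintype.sum_congr _ _ fun ρ => ?_
  rw [mul_smul, mul_smul, smul_comm _ (_ ^ _) (bracket _ _), smul_comm _ (_ ^ _) (bracket _ _), h]

end Glue

/-! ### State sums of diagrams in a disc -/

section Local

open Relation

variable {c k : ℕ}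

/-- Adjacency in the smoothing of a local diagram with edges `p`. Here `τ` records which positions
are joined at each crossing, regardless of the strand that passes over. -/
def localStep (p : LocalSlot c k → LocalSlot c k) (τ : Fin c → Bool) (s t : LocalSlot c k) : Prop :=
  t = p s ∨ ∃ x g, s = .inl (x, g) ∧ t = .inl (x, partner (τ x) g)

/-- The position to which a position at a crossing is joined in a smoothing. -/
def localMate (τ : Fin c → Bool) : LocalSlot c k → LocalSlot c k
  | .inl (x, g) => .inl (x, partner (τ x) g)
  | .inr j => .inr j

/-- A numbering of the positions in which the boundary points come first. -/
def slotCode : LocalSlot c k → ℕ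
  | .inl (x, g) => 2 * k + (4 * x + g)
  | .inr j => j

/-- The least number on the walk of length `N` from `s` that uses `p` and `m` in turn. -/
def walkMin {S : Type} (code : S → ℕ) : ℕ → (S → S) → (S → S) → S → ℕ
  | 0, _, _, s => code s
  | N + 1, p, m, s => min (code s) (walkMin code N m p (p s))

/-- The least number on a walk from `s` along the strand through `s`; the walk turns back at the
boundary points. The length `18` suffices for the diagrams of the Reidemeister moves. -/
def strandMin (p : LocalSlot c k → LocalSlot c k) (τ : Fin c → Bool) (s : LocalSlot c k) : ℕ :=
  walkMin slotCode 18 p (localMate τ) s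

/-- The number of closed strands in a smoothing, which are the strands on which the least number is
that of a position at a crossing. -/
def localLoops (p : LocalSlot c k → LocalSlot c k) (τ : Fin c → Bool) : ℕ :=
  (Finset.univ.filter fun s : Fin c × Fin 4 => strandMin p τ (.inl s) = slotCode (k := k) (.inl s)).card

/-- The least boundary point on the strand of a boundary point. -/
def localEnd (p : LocalSlot c k → LocalSlot c k) (τ : Fin c → Bool) (j : Fin (2 * k)) : ℕ :=
  strandMin p τ (.inr j)

/-- Joined positions have the same strand minimum, so that the walks are long enough. -/
def IsStrandInvariant (p : LocalSlot c k → LocalSlot c k) : Prop :=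
  ∀ τ s, strandMin p τ (p s) = strandMin p τ s ∧ strandMin p τ (localMate τ s) = strandMin p τ s

instance (p : LocalSlot c k → LocalSlot c k) : Decidable (IsStrandInvariant p) := by
  unfold IsStrandInvariant; infer_instance

theorem slotCode_injective : Function.Injective (slotCode : LocalSlot c k → ℕ) := by
  rintro (⟨x, g⟩ | j) (⟨y, g'⟩ | j') h <;> simp only [slotCode] at h
  · obtain rfl : x = y := Fin.ext (by omega)
    obtain rfl : g = g' := Fin.ext (by omega)
    rfl
  · omega
  · omega
  · rw [Fin.ext h]

theorem walkMin_le {S : Type} (code : S → ℕ) (N : ℕ) (p m : S → S) (s : S) :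
    walkMin code N p m s ≤ code s := by
  cases N
  · exact le_rfl
  · exact min_le_left _ _

theorem exists_code_eq_walkMin {S : Type} {r : S → S → Prop} (code : S → ℕ) (N : ℕ) {p m : S → S}
    (hp : ∀ s, EqvGen r s (p s)) (hm : ∀ s, EqvGen r s (m s)) (s : S) :
    ∃ t, EqvGen r s t ∧ code t = walkMin code N p m s := by
  induction N generalizing p m s with
  | zero => exact ⟨s, .refl s, rfl⟩
  | succ N ih =>
    rcases min_choice (code s) (walkMin code N m p (p s)) with h | h
    · exact ⟨s, .refl s, h.symm⟩
    · obtain ⟨t, ht, hc⟩ := ih hm hp (p s)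
      exact ⟨t, (hp s).trans _ _ _ ht, hc.trans h.symm⟩

theorem exists_slotCode_eq_strandMin (p : LocalSlot c k → LocalSlot c k) (τ : Fin c → Bool)
    (s : LocalSlot c k) : ∃ t, EqvGen (localStep p τ) s t ∧ slotCode t = strandMin p τ s := by
  refine exists_code_eq_walkMin (r := localStep p τ) _ _ (fun s => .rel _ _ (Or.inl rfl)) ?_ s
  rintro (⟨x, g⟩ | j)
  · exact .rel _ _ (Or.inr ⟨x, g, rfl, rfl⟩)
  · exact .refl _

theorem eqvGen_localStep_iff {p : LocalSlot c k → LocalSlot c k} (hp : IsStrandInvariant p)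
    (τ : Fin c → Bool) (s t : LocalSlot c k) :
    EqvGen (localStep p τ) s t ↔ strandMin p τ s = strandMin p τ t := by
  constructor
  · intro h
    induction h with
    | rel s t h =>
      rcases h with rfl | ⟨x, g, rfl, rfl⟩
      · exact (hp τ s).1.symm
      · exact (hp τ (.inl (x, g))).2.symm
    | refl s => rfl
    | symm s t _ h => exact h.symm
    | trans s t u _ _ h h' => exact h.trans h'
  · intro h
    obtain ⟨s', hs, hs'⟩ := exists_slotCode_eq_strandMin p τ s
    obtain ⟨t', ht, ht'⟩ := exists_slotCode_eq_strandMin p τ t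
    obtain rfl : s' = t' := slotCode_injective (by rw [hs', ht', h])
    exact hs.trans _ _ _ ht.symm

theorem freeClasses_localStep {p : LocalSlot c k → LocalSlot c k} (hp : IsStrandInvariant p)
    (τ : Fin c → Bool) : freeClasses (localStep p τ) Sum.inr = localLoops p τ := by
  have hmk : ∀ s t, Quot.mk (localStep p τ) s = Quot.mk _ t ↔ strandMin p τ s = strandMin p τ t :=
    fun s t => eqvGen_iff_mk_eq.symm.trans (eqvGen_localStep_iff hp τ s t)
  rw [localLoops, ← Fintype.card_subtype, ← Nat.card_eq_fintype_card]
  symm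
  refine Nat.card_congr (Equiv.ofBijective (fun s => ⟨Quot.mk _ (.inl s.1), fun j hj => ?_⟩)
    ⟨fun s t h => ?_, ?_⟩)
  · have h := (hmk _ _).1 hj
    have h' := walkMin_le slotCode 18 p (localMate τ) (.inr j)
    change strandMin p τ (.inr j) ≤ _ at h'
    rw [h, s.2] at h'
    simp only [slotCode] at h'
    omega
  · have h := (hmk _ _).1 (congrArg Subtype.val h)
    rw [s.2, t.2] at h
    exact Subtype.ext (Sum.inl_injective (slotCode_injective h))
  · rintro ⟨⟨u⟩, hu⟩
    obtain ⟨t, ht, hc⟩ := exists_slotCode_eq_strandMin p τ u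
    rcases t with t | j
    · have h := (eqvGen_localStep_iff hp τ _ _).1 ht
      exact ⟨⟨t, by rw [← h, hc]⟩, Subtype.ext ((hmk _ _).2 h.symm)⟩
    · exact (hu j (eqvGen_iff_mk_eq.1 ht).symm).elim

theorem localDiagram_resolvedStep_iff (r ρ : Fin c → Bool) (p : LocalSlot c k → LocalSlot c k)
    (h₁ : ∀ s, p (p s) = s) (h₂ : ∀ s, p s ≠ s)
    (s t : Slot (oneDisc k) (Fin c) (localDiagram r p h₁ h₂).V) :
    (localDiagram r p h₁ h₂).resolvedStep ρ s t ↔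
      localStep p (fun x => ρ x ^^ r x) (localSlot r s) (localSlot r t) := by
  have hpartner : ∀ (b b' : Bool) (a : Fin 4),
      (if b' then partner b a + 1 else partner b a) =
        partner (b ^^ b') (if b' then a + 1 else a) := by decide
  rw [Diagram.resolvedStep_iff]
  refine or_congr (Equiv.eq_symm_apply _) ⟨?_, ?_⟩
  · rintro (⟨v, -⟩ | ⟨x, a, rfl, rfl⟩)
    · exact v.elim
    · exact ⟨x, _, rfl, congrArg (fun g => Sum.inl (x, g)) (hpartner _ _ _)⟩
  · rintro ⟨x, g, hs, ht⟩
    have hs' := (Equiv.eq_symm_apply _).2 hs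
    have ht' := (Equiv.eq_symm_apply _).2 ht
    refine Or.inr ⟨x, _, hs', ht'.trans ((Equiv.symm_apply_eq _).2 ?_)⟩
    refine congrArg (fun g => Sum.inl (x, g)) (Eq.trans ?_ (hpartner _ _ _).symm)
    cases hr : r x <;> cases hρ : ρ x <;> simp [hr, hρ]

/-- The state sum in terms of the smoothings `τ = ρ + r` of the positions, which join the same
boundary points whichever strands pass over; `r` only enters into the powers of `-q`. -/
theorem bracket_localDiagram {M : Type} [AddCommGroup M] [Module Coeff M] (r : Fin c → Bool)
    {p : LocalSlot c k → LocalSlot c k} (hp : IsStrandInvariant p)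
    (h₁ : ∀ s, p (p s) = s) (h₂ : ∀ s, p s ≠ s) (W : (Fin (2 * k) → Fin (2 * k) → Prop) → M) :
    bracket (localDiagram r p h₁ h₂) W = ∑ τ : Fin c → Bool,
      (-LaurentPolynomial.T 2 : Coeff) ^ (∑ x, if τ x ^^ r x then 1 else 0) •
        loopValue ^ localLoops p τ • W fun i j => localEnd p τ i = localEnd p τ j := by
  have hinv : Function.Involutive fun (ρ : Fin c → Bool) x => ρ x ^^ r x := fun ρ => by
    ext x; simp
  refine Fintype.sum_equiv hinv.toPerm _ _ fun ρ => ?_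
  have hstep := localDiagram_resolvedStep_iff r ρ p h₁ h₂
  refine congrArg₂ (· • ·) (congrArg ((-LaurentPolynomial.T 2 : Coeff) ^ ·) ?_)
    (congrArg₂ (· • ·) (congrArg (loopValue ^ ·) ?_) (congrArg W ?_))
  · refine Fintype.sum_congr _ _ fun x => ?_
    simp [Function.Involutive.toPerm]
  · exact (freeClasses_congr (localSlot r) hstep (Equiv.refl (Fin (2 * k))) (b' := Sum.inr)
      fun _ => rfl).trans (freeClasses_localStep hp _)
  · funext i j
    exact propext ((eqvGen_congr (localSlot r) hstep _ _).trans (eqvGen_localStep_iff hp _ _ _))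

theorem sum_bool_pi_succ {M : Type} [AddCommMonoid M] {m : ℕ} (f : (Fin (m + 1) → Bool) → M) :
    ∑ τ, f τ = ∑ τ, f (Matrix.vecCons true τ) + ∑ τ, f (Matrix.vecCons false τ) := by
  rw [← (Fin.consEquiv fun _ => Bool).sum_comp, Fintype.sum_prod_type, Fintype.sum_bool]
  rfl

theorem sum_bool_pi_zero {M : Type} [AddCommMonoid M] (f : (Fin 0 → Bool) → M) : ∑ τ, f τ = f ![] :=
  (Fintype.sum_unique f).trans (congrArg f (Subsingleton.elim _ _))

theorem T_two_mul_loopValue : (LaurentPolynomial.T 2 : Coeff) * loopValue =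
    LaurentPolynomial.T 2 ^ 2 + 1 := by
  rw [loopValue, mul_add, ← LaurentPolynomial.T_add, ← LaurentPolynomial.T_add,
    LaurentPolynomial.T_pow, ← LaurentPolynomial.T_zero]
  rfl

end Local

/-! ### The local moves -/

section Moves

variable {M : Type} [AddCommGroup M] [Module Coeff M]

theorem isStrandInvariant_pairs1 : IsStrandInvariant pairs1 := by decide
theorem isStrandInvariant_pairs1' : IsStrandInvariant pairs1' := by decide +kernel
theorem isStrandInvariant_pairs2 : IsStrandInvariant pairs2 := by decide
theorem isStrandInvariant_pairs2' : IsStrandInvariant pairs2' := by decide +kernel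
theorem isStrandInvariant_pairs3 : IsStrandInvariant pairs3 := by decide +kernel
theorem isStrandInvariant_pairs3' : IsStrandInvariant pairs3' := by decide +kernel

theorem localState_eq {c k : ℕ} {p : LocalSlot c k → LocalSlot c k} {τ : Fin c → Bool}
    (W : (Fin (2 * k) → Fin (2 * k) → Prop) → M) (l : ℕ) (v : Fin (2 * k) → ℕ)
    (h : localLoops p τ = l ∧ localEnd p τ = v) :
    loopValue ^ localLoops p τ • W (fun i j => localEnd p τ i = localEnd p τ j) =
      loopValue ^ l • W (fun i j => v i = v j) := by
  rw [h.1, h.2]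

theorem bracket_pairs1 (W : (Fin (2 * 1) → Fin (2 * 1) → Prop) → M) (r : Fin 0 → Bool) :
    bracket (localDiagram r pairs1 (by decide) (by decide)) W =
      W fun i j => (![0, 0] : _ → ℕ) i = (![0, 0] : _ → ℕ) j := by
  rw [bracket_localDiagram r isStrandInvariant_pairs1, sum_bool_pi_zero,
    localState_eq W 0 ![0, 0] (by decide +kernel)]
  simp

theorem bracket_pairs1' (W : (Fin (2 * 1) → Fin (2 * 1) → Prop) → M) (r : Bool) :
    bracket (localDiagram (fun _ => r) pairs1' (by decide) (by decide)) W =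
      (if r then -LaurentPolynomial.T 4 else LaurentPolynomial.T (-2) : Coeff) •
        W fun i j => (![0, 0] : _ → ℕ) i = (![0, 0] : _ → ℕ) j := by
  rw [bracket_localDiagram _ isStrandInvariant_pairs1']
  simp only [sum_bool_pi_succ, sum_bool_pi_zero, Fin.sum_univ_one, Matrix.cons_val_zero]
  rw [localState_eq (τ := ![true]) W 0 ![0, 0] (by decide +kernel),
    localState_eq (τ := ![false]) W 1 ![0, 0] (by decide +kernel)]
  have h4 : (LaurentPolynomial.T 4 : Coeff) = LaurentPolynomial.T 2 ^ 2 := by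
    rw [LaurentPolynomial.T_pow]; rfl
  have hx := T_two_mul_loopValue
  have hl : loopValue = LaurentPolynomial.T 2 + LaurentPolynomial.T (-2) := rfl
  rw [h4]
  generalize (LaurentPolynomial.T 2 : Coeff) = x at hx hl ⊢
  generalize (LaurentPolynomial.T (-2) : Coeff) = y at hl ⊢
  cases r <;> match_scalars <;> simp
  · linear_combination hl
  · linear_combination -hx

theorem bracket_pairs2 (W : (Fin (2 * 2) → Fin (2 * 2) → Prop) → M) (r : Fin 0 → Bool) :
    bracket (localDiagram r pairs2 (by decide) (by decide)) W =
      W fun i j => (![0, 1, 1, 0] : _ → ℕ) i = (![0, 1, 1, 0] : _ → ℕ) j := by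
  rw [bracket_localDiagram r isStrandInvariant_pairs2, sum_bool_pi_zero,
    localState_eq W 0 ![0, 1, 1, 0] (by decide +kernel)]
  simp

theorem bracket_pairs2' (W : (Fin (2 * 2) → Fin (2 * 2) → Prop) → M) (r : Bool) :
    bracket (localDiagram (fun _ => r) pairs2' (by decide) (by decide)) W =
      (-LaurentPolynomial.T 2 : Coeff) •
        W fun i j => (![0, 1, 1, 0] : _ → ℕ) i = (![0, 1, 1, 0] : _ → ℕ) j := by
  rw [bracket_localDiagram _ isStrandInvariant_pairs2']
  simp only [sum_bool_pi_succ, sum_bool_pi_zero, Fin.sum_univ_two, Matrix.cons_val_zero,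
    Matrix.cons_val_one]
  rw [localState_eq (τ := ![true, true]) W 0 ![0, 0, 2, 2] (by decide +kernel),
    localState_eq (τ := ![true, false]) W 1 ![0, 0, 2, 2] (by decide +kernel),
    localState_eq (τ := ![false, true]) W 0 ![0, 1, 1, 0] (by decide +kernel),
    localState_eq (τ := ![false, false]) W 0 ![0, 0, 2, 2] (by decide +kernel)]
  have hx := T_two_mul_loopValue
  generalize (LaurentPolynomial.T 2 : Coeff) = x at hx ⊢
  cases r <;> match_scalars <;> simp <;> linear_combination -hx

/-- The smoothing of the triangle with a closed strand and three other smoothings join the boundary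
points in the same way. Unless `r` alternates, which it does not for strands at different heights,
the one with the closed strand cancels two of these three because of `q (q + q⁻¹) = 1 + q²`. What
remains is the same on both sides of the move. -/
theorem bracket_pairs3 (W : (Fin (2 * 3) → Fin (2 * 3) → Prop) → M) (r : Fin 3 → Bool)
    (hr : r 1 = r 0 ∨ r 1 = r 2) :
    bracket (localDiagram r pairs3 (by decide) (by decide)) W =
      bracket (localDiagram r pairs3' (by decide) (by decide)) W := by
  rw [bracket_localDiagram _ isStrandInvariant_pairs3,
    bracket_localDiagram _ isStrandInvariant_pairs3']
  simp only [sum_bool_pi_succ, sum_bool_pi_zero, Fin.sum_univ_three, Matrix.cons_val_zero,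
    Matrix.cons_val_one, Matrix.cons_val]
  rw [localState_eq (p := pairs3) (τ := ![true, true, true]) W 0 ![0, 1, 2, 2, 1, 0]
      (by decide +kernel),
    localState_eq (p := pairs3) (τ := ![true, true, false]) W 0 ![0, 0, 2, 2, 4, 4]
      (by decide +kernel),
    localState_eq (p := pairs3) (τ := ![true, false, true]) W 0 ![0, 1, 1, 3, 3, 0]
      (by decide +kernel),
    localState_eq (p := pairs3) (τ := ![true, false, false]) W 0 ![0, 1, 1, 0, 4, 4]
      (by decide +kernel),
    localState_eq (p := pairs3) (τ := ![false, true, true]) W 0 ![0, 0, 2, 2, 4, 4]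
      (by decide +kernel),
    localState_eq (p := pairs3) (τ := ![false, true, false]) W 1 ![0, 0, 2, 2, 4, 4]
      (by decide +kernel),
    localState_eq (p := pairs3) (τ := ![false, false, true]) W 0 ![0, 0, 2, 3, 3, 2]
      (by decide +kernel),
    localState_eq (p := pairs3) (τ := ![false, false, false]) W 0 ![0, 0, 2, 2, 4, 4]
      (by decide +kernel),
    localState_eq (p := pairs3') (τ := ![true, true, true]) W 0 ![0, 1, 2, 2, 1, 0]
      (by decide +kernel),
    localState_eq (p := pairs3') (τ := ![true, true, false]) W 0 ![0, 1, 1, 3, 3, 0]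
      (by decide +kernel),
    localState_eq (p := pairs3') (τ := ![true, false, true]) W 0 ![0, 0, 2, 2, 4, 4]
      (by decide +kernel),
    localState_eq (p := pairs3') (τ := ![true, false, false]) W 0 ![0, 1, 1, 0, 4, 4]
      (by decide +kernel),
    localState_eq (p := pairs3') (τ := ![false, true, true]) W 0 ![0, 1, 1, 3, 3, 0]
      (by decide +kernel),
    localState_eq (p := pairs3') (τ := ![false, true, false]) W 1 ![0, 1, 1, 3, 3, 0]
      (by decide +kernel),
    localState_eq (p := pairs3') (τ := ![false, false, true]) W 0 ![0, 0, 2, 3, 3, 2]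
      (by decide +kernel),
    localState_eq (p := pairs3') (τ := ![false, false, false]) W 0 ![0, 1, 1, 3, 3, 0]
      (by decide +kernel)]
  have hx := T_two_mul_loopValue
  generalize (LaurentPolynomial.T 2 : Coeff) = x at hx ⊢
  generalize loopValue = δ at hx ⊢
  generalize W (fun i j => (![0, 1, 2, 2, 1, 0] : _ → ℕ) i = (![0, 1, 2, 2, 1, 0] : _ → ℕ) j) = W₁
  generalize W (fun i j => (![0, 0, 2, 2, 4, 4] : _ → ℕ) i = (![0, 0, 2, 2, 4, 4] : _ → ℕ) j) = W₂
  generalize W (fun i j => (![0, 1, 1, 3, 3, 0] : _ → ℕ) i = (![0, 1, 1, 3, 3, 0] : _ → ℕ) j) = W₃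
  generalize W (fun i j => (![0, 1, 1, 0, 4, 4] : _ → ℕ) i = (![0, 1, 1, 0, 4, 4] : _ → ℕ) j) = W₄
  generalize W (fun i j => (![0, 0, 2, 3, 3, 2] : _ → ℕ) i = (![0, 0, 2, 3, 3, 2] : _ → ℕ) j) = W₅
  cases h0 : r 0 <;> cases h1 : r 1 <;> cases h2 : r 2 <;> simp [h0, h1, h2] at hr <;>
    simp only [Bool.xor_true, Bool.xor_false, Bool.not_true, Bool.not_false,
      if_true, Bool.false_eq_true, if_false] <;>
    match_scalars <;> grind

end Moves

/-! ### Reidemeister moves -/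

section Invariance

variable {ι : Type} {n : Option ι → ℕ} {X : Type} {c k : ℕ} {R : Diagram (addDisc n k) X}
  {r : Fin c → Bool} {p : LocalSlot c k → LocalSlot c k} {h₁ : ∀ s, p (p s) = s}
  {h₂ : ∀ s, p s ≠ s}

/-- The orientation of a local diagram, at the positions. -/
def localOut (o : StrandOrientation (glue R (localDiagram r p h₁ h₂))) (s : LocalSlot c k) : Bool :=
  o.out ((glueEquiv R _).symm (.inr ((localSlot r).symm s)))

theorem localOut_edge (o : StrandOrientation (glue R (localDiagram r p h₁ h₂)))
    (s : LocalSlot c k) : localOut o (p s) = !localOut o s := by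
  rw [localOut, localOut, ← o.out_edge, glue_edge_symm]
  refine congrArg (fun t => o.out ((glueEquiv R _).symm (.inr t))) ?_
  exact (congrArg (fun s => (localSlot r).symm (p s)) ((localSlot r).apply_symm_apply s)).symm

theorem localOut_cross (o : StrandOrientation (glue R (localDiagram r p h₁ h₂))) (x : Fin c)
    (g : Fin 4) : localOut o (.inl (x, g + 2)) = !localOut o (.inl (x, g)) := by
  have h := o.out_cross (.inr x) (if r x then g - 1 else g)
  refine Eq.trans (congrArg (fun a => o.out (.cross (.inr x) a)) ?_) h
  cases r x
  · rfl
  · exact add_sub_right_comm g 2 1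

theorem localOut_bdry (o : StrandOrientation (glue R (localDiagram r p h₁ h₂)))
    (j : Fin (2 * k)) :
    localOut o (.inr j) = !o.out ((glueEquiv R _).symm (.inl (.bdry (some none) j))) :=
  o.out_mark (.inr (.inr j)) false

/-- If `r x` holds, then the ends `0` and `1` have the positions `1` and `2`, and the direction at `2`
is opposite to that at `0`; hence the additional `r x`. -/
theorem isPositive_iff_localOut (o : StrandOrientation (glue R (localDiagram r p h₁ h₂)))
    (x : Fin c) : o.IsPositive (.inr x) ↔
      (localOut o (.inl (x, 0)) ^^ localOut o (.inl (x, 1)) ^^ r x) = true := by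
  have key : ∀ a, o.out (.cross (.inr x) a) = localOut o (.inl (x, if r x then a + 1 else a)) :=
    fun a => congrArg (fun s => o.out ((glueEquiv R _).symm (.inr s)))
      ((localSlot r).symm_apply_apply (.cross x a)).symm
  have h := localOut_cross o x 0
  rw [StrandOrientation.IsPositive, key, key]
  cases hr : r x
  · simp
  · simp only [if_true]
    change localOut o (.inl (x, 1)) ≠ localOut o (.inl (x, 0 + 2)) ↔ _
    rw [h]
    cases localOut o (.inl (x, 0)) <;> cases localOut o (.inl (x, 1)) <;> simp

/-- The two diagrams of a local move have the same normalised partition map: their state sums differ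
by the contributions of the crossings in the disc to the normalisation. -/
theorem LocalMove.Z_eq [Finite ι] [Fintype X] [DecidableEq X] {c' : ℕ}
    {A : Diagram (oneDisc k) (Fin c)} {B : Diagram (oneDisc k) (Fin c')} (h : LocalMove A B)
    (o₁ : StrandOrientation (glue R A)) (o₂ : StrandOrientation (glue R B))
    (ho : ∀ s, o₁.out (glueSlot.symm (.inl s)) = o₂.out (glueSlot.symm (.inl s))) :
    o₁.Z = o₂.Z := by
  refine glue_Z_congr o₁ o₂ ho fun ρ => ?_
  cases h with
  | one r =>
    rw [bracket_pairs1, bracket_pairs1', Fintype.prod_empty, Fin.prod_univ_one, one_smul, smul_smul]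
    have hpos : o₂.IsPositive (.inr 0) ↔ r = false := by
      have h01 := localOut_edge o₂ (.inl (0, 0))
      rw [isPositive_iff_localOut, show localOut o₂ (.inl (0, 1)) = _ from h01]
      cases r <;> simp
    rw [crossingWeight]
    cases r
    · rw [if_pos (hpos.2 rfl), if_neg Bool.false_ne_true, ← LaurentPolynomial.T_add, add_neg_cancel,
        LaurentPolynomial.T_zero, one_smul]
    · rw [if_neg fun h => Bool.false_ne_true (hpos.1 h).symm, if_pos rfl, neg_mul_neg,
        ← LaurentPolynomial.T_add, neg_add_cancel, LaurentPolynomial.T_zero, one_smul]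
  | two r =>
    rw [bracket_pairs2, bracket_pairs2', Fintype.prod_empty, Fin.prod_univ_two, one_smul, smul_smul]
    -- The over strand passes the two crossings in opposite directions across the under strand.
    have hpos : o₂.IsPositive (.inr 1) ↔ ¬ o₂.IsPositive (.inr 0) := by
      have e₁ : localOut o₂ (.inl (1, 1)) = _ := localOut_edge o₂ (.inl (0, 1))
      have e₂ : localOut o₂ (.inl (1, 0)) = _ := localOut_edge o₂ (.inl (0, 2))
      have e₃ : localOut o₂ (.inl (0, 2)) = _ := localOut_cross o₂ 0 0
      rw [isPositive_iff_localOut, isPositive_iff_localOut, e₁, e₂, e₃]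
      cases localOut o₂ (.inl (0, 0)) <;> cases localOut o₂ (.inl (0, 1)) <;> cases r <;> simp
    rw [crossingWeight, crossingWeight]
    have h1 : (LaurentPolynomial.T 2 * -LaurentPolynomial.T (-4) : Coeff) * -LaurentPolynomial.T 2 =
        1 := by
      rw [mul_neg, mul_neg, neg_mul, neg_neg, ← LaurentPolynomial.T_add, ← LaurentPolynomial.T_add,
        ← LaurentPolynomial.T_zero]
      rfl
    by_cases h0 : o₂.IsPositive (.inr 0)
    · rw [if_pos h0, if_neg fun h => hpos.1 h h0, h1, one_smul]
    · rw [if_neg h0, if_pos (hpos.2 h0), mul_comm (-_), h1, one_smul]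
  | three h =>
    have hr : heights h 1 = heights h 0 ∨ heights h 1 = heights h 2 := by
      simp only [heights, decide_eq_decide]
      omega
    rw [bracket_pairs3 _ _ hr]
    congr 1
    -- Each strand has the same direction before and after the move.
    have hb : ∀ j : Fin 6, localOut o₁ (.inr j) = localOut o₂ (.inr j) := fun j => by
      rw [localOut_bdry, localOut_bdry]
      exact congrArg _ (ho _)
    have hpos : ∀ x, (localOut o₁ (.inl (x, 0)) = localOut o₂ (.inl (x, 0))) →
        (localOut o₁ (.inl (x, 1)) = localOut o₂ (.inl (x, 1))) →
        crossingWeight o₁ (.inr x) = crossingWeight o₂ (.inr x) := fun x h0 h1 =>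
      crossingWeight_congr (by rw [isPositive_iff_localOut, isPositive_iff_localOut, h0, h1])
    have a₀ : localOut o₁ (.inl (0, 0)) = _ := localOut_edge o₁ (.inr 0)
    have a₁ : localOut o₁ (.inl (0, 1)) = _ := localOut_edge o₁ (.inr 1)
    have a₂ : localOut o₁ (.inl (1, 1)) = _ := localOut_edge o₁ (.inr 2)
    have a₃ : localOut o₁ (.inl (0, 2)) = _ := localOut_cross o₁ 0 0
    have a₄ : localOut o₁ (.inl (0, 3)) = _ := localOut_cross o₁ 0 1
    have a₅ : localOut o₁ (.inl (1, 3)) = _ := localOut_cross o₁ 1 1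
    have a₆ : localOut o₁ (.inl (1, 0)) = _ := localOut_edge o₁ (.inl (0, 2))
    have a₇ : localOut o₁ (.inl (2, 0)) = _ := localOut_edge o₁ (.inl (0, 3))
    have a₈ : localOut o₁ (.inl (2, 1)) = _ := localOut_edge o₁ (.inl (1, 3))
    have b₀ : localOut o₂ (.inl (1, 0)) = _ := localOut_edge o₂ (.inr 0)
    have b₁ : localOut o₂ (.inl (2, 0)) = _ := localOut_edge o₂ (.inr 1)
    have b₂ : localOut o₂ (.inl (2, 1)) = _ := localOut_edge o₂ (.inr 2)
    have b₃ : localOut o₂ (.inl (1, 2)) = _ := localOut_cross o₂ 1 0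
    have b₄ : localOut o₂ (.inl (2, 2)) = _ := localOut_cross o₂ 2 0
    have b₅ : localOut o₂ (.inl (2, 3)) = _ := localOut_cross o₂ 2 1
    have b₆ : localOut o₂ (.inl (0, 0)) = _ := localOut_edge o₂ (.inl (1, 2))
    have b₇ : localOut o₂ (.inl (0, 1)) = _ := localOut_edge o₂ (.inl (2, 2))
    have b₈ : localOut o₂ (.inl (1, 1)) = _ := localOut_edge o₂ (.inl (2, 3))
    rw [Fin.prod_univ_three, Fin.prod_univ_three, hpos 0, hpos 1, hpos 2] <;>
      simp only [a₀, a₁, a₂, a₃, a₄, a₅, a₆, a₇, a₈, b₀, b₁, b₂, b₃, b₄, b₅, b₆, b₇, b₈,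
        Bool.not_not] <;>
      simpa using hb _

theorem ReidemeisterMove.Z_eq [Finite ι] {𝔻 : DiscConfig ι} {T₁ T₂ : TangleDiagram 𝔻 n}
    (h : ReidemeisterMove T₁ T₂) : T₁.Z = T₂.Z := by
  classical
  obtain ⟨Δ, hΔ, k, c, c', X, R, -, A, B, o₁, o₂, hAB, ho, hs₁, hs₂⟩ := h
  obtain ⟨e, -⟩ := id hs₁
  have : Finite X := Finite.of_injective (e.symm ∘ Sum.inl) (e.symm.injective.comp Sum.inl_injective)
  have : Fintype X := Fintype.ofFinite X
  rw [T₁.Z_eq, T₂.Z_eq, hs₁.Z_eq, hs₂.Z_eq, hAB.Z_eq o₁ o₂ ho]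

end Invariance

end Tangle

end

theorem mainTheorem2 {ι : Type} [Finite ι] (𝔻 : Tangle.DiscConfig ι) (n : Option ι → ℕ)
    (T₁ T₂ : Tangle.TangleDiagram 𝔻 n) :
    (Tangle.ReidemeisterMove T₁ T₂ → T₁.Z = T₂.Z) ∧
      (Tangle.ReidemeisterEquiv T₁ T₂ → T₁.Z = T₂.Z) := by
  refine ⟨fun h => h.Z_eq, fun h => ?_⟩
  induction h with
  | rel T T' h => exact h.elim (fun h => by rw [T.Z_eq, T'.Z_eq, h.Z_eq]) fun h => h.Z_eq
  | refl T => rfl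
  | symm T T' _ h => exact h.symm
  | trans T T' T'' _ _ h h' => exact h.trans h'
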